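/- **Uniform Lipschitz character of flows.** Let $M$ be a $C^\infty$-manifold (finite-dimensional, without boundary, Hausdorff, second countable, connected), let $\mathbb G$ be a $C^\infty$ Riemannian metric on $M$ with Levi-Civita connection $\nabla$ and Riemannian distance $d_{\mathbb G}$, let $\mathbb T\subseteq\mathbb R$ be an interval and let $\mathcal P$ be a topological space. For a locally Lipschitz vector field $\xi$ on $M$ and $x\in M$ put $$\operatorname{dil}\xi(x)=\inf_{\mathcal U}\ \sup\{\|\nabla_{v}\xi\|_{\mathbb G} : y\in \operatorname{cl}(\mathcal U),\ v\in T_yM,\ \|v\|_{\mathbb G}=1,\ \xi \text{ differentiable at } y\},$$ the infimum being over the relatively compact neighbourhoods $\mathcal U$ of $x$, and for $K\subseteq M$ compact put $p_K(\xi)=\max\{\sup_{x\in K}\operatorname{dil}\xi(x),\ \sup_{x\in K}\|\xi(x)\|_{\mathbb G}\}$. Let $X\in\Gamma^{\mathrm{lip}}_{\mathrm{PLI}}(\mathbb T;TM;\mathcal P)$, i.e. let $X(t,x,p)\in T_xM$ for $(t,x,p)\in\mathbb T\times M\times\mathcal P$, write $X^p_t=X(t,\cdot,p)$, and suppose that 1.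 for every $p\in\mathcal P$: every $X^p_t$, $t\in\mathbb T$, is a locally Lipschitz vector field; $t\mapsto X(t,x,p)$ is measurable for every $x\in M$; and $t\mapsto p_K(X^p_t)$ is Lebesgue integrable on $\mathbb S$ for all compact $K\subseteq M$ and $\mathbb S\subseteq\mathbb T$; 2. $p\mapsto X(t,x,p)$ is continuous for every $(t,x)\in\mathbb T\times M$; 3. for every $q\in\mathcal P$, all compact $K\subseteq M$ and $\mathbb S\subseteq\mathbb T$ and every $\epsilon>0$ there is a neighbourhood of $q$ such that $\int_{\mathbb S}p_K(X^p_t-X^{q}_t)\,dt<\epsilon$ for all $p$ in it. An integral curve of $X^p$ is a curve $\xi:J\to M$ on an interval $J\subseteq\mathbb T$ which is locally absolutely continuous (that is, $f\circ\xi$ is locally absolutely continuous for every $f\in C^\infty(M)$) and satisfies $\xi'(t)=X(t,\xi(t),p)$ for almost every $t\in J$. Let $D_X\subseteq\mathbb T\times\mathbb T\times M\times\mathcal P$ be the set of all $(t_1,t_0,x,p)$ for which there is an integral curve of $X^p$ defined on an interval containing $t_0$ and $t_1$ and taking the value $x$ at $t_0$, and let $\Phi^X(t_1,t_0,x,p)$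 be its value at $t_1$. Let $|t_0,t_1|$ denote the closed interval with endpoints $t_0$ and $t_1$. Let $K\subseteq M$ be compact, let $t_0,t_1\in\mathbb T$ and let $p_0\in\mathcal P$ be such that $$|t_0,t_1|\times\{t_0\}\times K\times\{p_0\}\subseteq D_X .$$ Then there exist a neighbourhood $\mathcal O\subseteq\mathcal P$ of $p_0$ and a constant $C>0$ such that $|t_0,t_1|\times\{t_0\}\times K\times\mathcal O\subseteq D_X$ and $$d_{\mathbb G}\big(\Phi^X(t,t_0,x_1,p),\Phi^X(t,t_0,x_2,p)\big)\le C\,d_{\mathbb G}(x_1,x_2),\qquad t\in|t_0,t_1|,\ x_1,x_2\in K,\ p\in\mathcal O .$$ -/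

import Mathlib

open Set Filter MeasureTheory Bundle
open scoped Manifold ContDiff Topology ENNReal NNReal

noncomputable section

namespace LipFlow

/-! ### Lipschitz vector fields and the seminorms of the `C^lip`-topology -/

section Seminorms

variable {E : Type*} [NormedAddCommGroup E] [NormedSpace ℝ E]
  {M : Type*} [TopologicalSpace M] [ChartedSpace E M] [IsManifold 𝓘(ℝ, E) ∞ M]

/-- `ξ` is a locally Lipschitz vector field (an element of `Γ^lip(TM)`): around every point `x₀`,
its local representative in the coordinates of the chart at `x₀` is Lipschitz. -/
def IsLipSection (ξ : (x : M) → TangentSpace 𝓘(ℝ, E) x) : Prop :=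
  ∀ x₀ : M, ∃ C : ℝ≥0, ∃ U ∈ 𝓝 x₀, ∀ y ∈ U, ∀ z ∈ U,
    ‖(trivializationAt E (TangentSpace 𝓘(ℝ, E)) x₀ ⟨y, ξ y⟩).2
        - (trivializationAt E (TangentSpace 𝓘(ℝ, E)) x₀ ⟨z, ξ z⟩).2‖
      ≤ C * ‖extChartAt 𝓘(ℝ, E) x₀ y - extChartAt 𝓘(ℝ, E) x₀ z‖

variable [RiemannianBundle (fun x : M => TangentSpace 𝓘(ℝ, E) x)]

/-- `nabla` is the Levi-Civita connection of the Riemannian metric: a smooth affine connection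
which is torsion-free and compatible with the metric, that is,
`v⟨σ, τ⟩ = ⟨∇_v σ, τ⟩ + ⟨σ, ∇_v τ⟩` for tangent vectors `v` at `x` and vector fields `σ`, `τ` that
are differentiable at `x`. In Mathlib's notation `nabla σ x v` is `∇_v σ`. -/
structure IsLeviCivita [FiniteDimensional ℝ E]
    (nabla : CovariantDerivative 𝓘(ℝ, E) E (fun x : M => TangentSpace 𝓘(ℝ, E) x)) : Prop where
  smooth : nabla.ContMDiffCovariantDerivative ∞
  torsion_free : nabla.torsion = 0
  metric : ∀ (x : M) (v : TangentSpace 𝓘(ℝ, E) x) (σ τ : (y : M) → TangentSpace 𝓘(ℝ, E) y),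
    MDifferentiableAt 𝓘(ℝ, E) (𝓘(ℝ, E).prod 𝓘(ℝ, E))
      (fun z => (⟨z, σ z⟩ : TangentBundle 𝓘(ℝ, E) M)) x →
    MDifferentiableAt 𝓘(ℝ, E) (𝓘(ℝ, E).prod 𝓘(ℝ, E))
      (fun z => (⟨z, τ z⟩ : TangentBundle 𝓘(ℝ, E) M)) x →
    (mfderiv 𝓘(ℝ, E) 𝓘(ℝ, ℝ) (fun y => inner ℝ (σ y) (τ y)) x v : ℝ)
      = inner ℝ (nabla σ x v) (τ x) + inner ℝ (σ x) (nabla τ x v)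

variable (nabla : CovariantDerivative 𝓘(ℝ, E) E (fun x : M => TangentSpace 𝓘(ℝ, E) x))

/-- The local sectional dilatation `dil ξ (x)`: the infimum, over the relatively compact
neighbourhoods `U` of `x`, of the supremum of `‖∇_v ξ‖` over the unit tangent vectors `v` at the
points `y ∈ cl(U)` at which `ξ` is differentiable. -/
def dil (ξ : (x : M) → TangentSpace 𝓘(ℝ, E) x) (x : M) : ℝ≥0∞ :=
  ⨅ (U : Set M) (_ : U ∈ 𝓝 x) (_ : IsCompact (closure U)),
    ⨆ (y : M) (_ : y ∈ closure U)
      (_ : MDifferentiableAt 𝓘(ℝ, E) (𝓘(ℝ, E).prod 𝓘(ℝ, E))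
        (fun z => (⟨z, ξ z⟩ : TangentBundle 𝓘(ℝ, E) M)) y)
      (v : TangentSpace 𝓘(ℝ, E) y) (_ : ‖v‖ = 1), ‖nabla ξ y v‖ₑ

/-- The seminorm `p_K^lip(ξ) = max (sup_K dil ξ) (sup_K ‖ξ‖)` of the `C^lip`-topology. -/
def pLip (K : Set M) (ξ : (x : M) → TangentSpace 𝓘(ℝ, E) x) : ℝ≥0∞ :=
  max (⨆ x ∈ K, dil nabla ξ x) (⨆ x ∈ K, ‖ξ x‖ₑ)

/-- `X` is a locally integrally `C^lip`-bounded time-dependent vector field on the time interval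
`T`, i.e. `X ∈ Γ^lip_LI(T; TM)`: each `X_t` is locally Lipschitz, `t ↦ X_t` is measurable, and
`t ↦ p_K^lip(X_t)` is integrable on every compact `S ⊆ T`, for every compact `K ⊆ M`.
Values at times outside `T` are irrelevant. -/
structure IsLipLI (T : Set ℝ) (X : ℝ → (x : M) → TangentSpace 𝓘(ℝ, E) x) : Prop where
  lip : ∀ t ∈ T, IsLipSection (X t)
  measurable : ∀ x : M, AEStronglyMeasurable (fun t => X t x) (volume.restrict T)
  integrable : ∀ K : Set M, IsCompact K → ∀ S ⊆ T, IsCompact S →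
    AEMeasurable (fun t => pLip nabla K (X t)) (volume.restrict S) ∧
      ∫⁻ t in S, pLip nabla K (X t) < ⊤

/-- `X` is a parameter-dependent, locally integrally bounded vector field of class `C^lip`,
i.e. `X ∈ Γ^lip_PLI(T; TM; P)`; `X p t x` is the value at the parameter `p`, time `t`, state `x`.
The last field is the continuity of `p ↦ X^p` for the seminorms
`ξ ↦ ∫_S p_K^lip(ξ_t) dt`. -/
structure IsLipPLI {P : Type*} [TopologicalSpace P] (T : Set ℝ)
    (X : P → ℝ → (x : M) → TangentSpace 𝓘(ℝ, E) x) : Prop where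
  isLipLI : ∀ p, IsLipLI nabla T (X p)
  continuous_param : ∀ t ∈ T, ∀ x : M, Continuous fun p => X p t x
  continuous : ∀ p₀ : P, ∀ K : Set M, IsCompact K → ∀ S ⊆ T, IsCompact S →
    ∀ ε : ℝ≥0∞, 0 < ε → ∀ᶠ p in 𝓝 p₀,
      AEMeasurable (fun t => pLip nabla K (X p t - X p₀ t)) (volume.restrict S) ∧
        ∫⁻ t in S, pLip nabla K (X p t - X p₀ t) < ε

end Seminorms

/-! ### Integral curves and flows -/

section Flow

variable {E : Type*} [NormedAddCommGroup E] [NormedSpace ℝ E]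
  {M : Type*} [TopologicalSpace M] [ChartedSpace E M]

/-- `γ` restricted to the interval `J` is locally absolutely continuous: its composition with
every smooth function on `M` is absolutely continuous on every compact subinterval of `J`. -/
def LocACOn (γ : ℝ → M) (J : Set ℝ) : Prop :=
  ∀ f : M → ℝ, ContMDiff 𝓘(ℝ, E) 𝓘(ℝ, ℝ) ∞ f →
    ∀ a ∈ J, ∀ b ∈ J, AbsolutelyContinuousOnInterval (f ∘ γ) a b

/-- `γ : J → M` is an integral curve of the time-dependent vector field `X` on `T`, where `J` is a
subinterval of `T`. Values of `γ` outside `J` are irrelevant. -/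
structure IsIntCurve (T : Set ℝ) (X : ℝ → (x : M) → TangentSpace 𝓘(ℝ, E) x)
    (γ : ℝ → M) (J : Set ℝ) : Prop where
  ordConnected : J.OrdConnected
  subset : J ⊆ T
  locAC : LocACOn (E := E) γ J
  deriv : ∀ᵐ t : ℝ, t ∈ J → HasMFDerivWithinAt 𝓘(ℝ, ℝ) 𝓘(ℝ, E) γ J t
    ((1 : ℝ →L[ℝ] ℝ).smulRight (X t (γ t)))

/-- There is an integral curve of `X` which is at `x₀` at time `t₀`, is still defined at
time `t₁`, and is at `y` at time `t₁`. -/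
def Reaches (T : Set ℝ) (X : ℝ → (x : M) → TangentSpace 𝓘(ℝ, E) x) (t₁ t₀ : ℝ) (x₀ y : M) :
    Prop :=
  ∃ (J : Set ℝ) (γ : ℝ → M), IsIntCurve T X γ J ∧ t₀ ∈ J ∧ γ t₀ = x₀ ∧ t₁ ∈ J ∧ γ t₁ = y

/-- The interval of existence `J_X(t₀, x₀, p₀)`: the union of the intervals `J ⊆ T` on which there
is an integral curve of `X^{p₀}` with value `x₀` at time `t₀`. -/
def existenceInterval {P : Type*} (T : Set ℝ) (X : P → ℝ → (x : M) → TangentSpace 𝓘(ℝ, E) x)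
    (t₀ : ℝ) (x₀ : M) (p₀ : P) : Set ℝ :=
  {t₁ | ∃ y, Reaches T (X p₀) t₁ t₀ x₀ y}

/-- The domain `D_X ⊆ T × T × M × P` of the flow of `X`. -/
def flowDomain {P : Type*} (T : Set ℝ) (X : P → ℝ → (x : M) → TangentSpace 𝓘(ℝ, E) x) :
    Set (ℝ × ℝ × M × P) :=
  {q | q.1 ∈ T ∧ q.2.1 ∈ T ∧ q.1 ∈ existenceInterval T X q.2.1 q.2.2.1 q.2.2.2}

open Classical in
/-- The flow `Φ^X(t₁, t₀, x₀, p₀) = ξ(t₁)`, where `ξ` is the integral curve of `X^{p₀}` with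
`ξ(t₀) = x₀`; only its values on `flowDomain T X` are meaningful. -/
def flow {P : Type*} (T : Set ℝ) (X : P → ℝ → (x : M) → TangentSpace 𝓘(ℝ, E) x)
    (t₁ t₀ : ℝ) (x₀ : M) (p₀ : P) : M :=
  if h : ∃ y, Reaches T (X p₀) t₁ t₀ x₀ y then h.choose else x₀

end Flow

end LipFlow

end

/-!
In the chart at a point, Rademacher's theorem converts the bound on `∇ξ` in `p_K^lip` into a
Lipschitz constant: in a small chart ball with image `K`, the local representative of `ξ` is bounded
by `C p_K^lip(ξ)` and is `C p_K^lip(ξ)`-Lipschitz, the Christoffel symbols being absorbed by the sup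
norm. Hence the local representatives of the `X^p` satisfy Carathéodory's conditions with the
majorant `C p_K^lip(X^p_t)`, whose integral over a short time interval is small uniformly for `p`
near `p₀`. On such an interval, Picard's contraction argument yields existence, and the integral
equation yields that the flow is Lipschitz in the initial value and that its values for `p` near
`p₀` are close to those for `p₀`.

The relations expressing that `y` is reached from `x` along an integral curve compose, so the
compactness of an integral curve of `X^{p₀}` propagates the estimates from short times to the whole
curve, uniformly near its initial value and near `p₀`. Finitely many of these neighbourhoods cover
`K`; pairs of points at distance less than a Lebesgue number are covered by the local estimates, and
for the other pairs the distance of the images is at most that of the points plus a bounded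
displacement.
-/

noncomputable section

namespace LipFlow

/-! ### Absolute continuity and the fundamental theorem of calculus -/

section Calculus

variable {F : Type*} [NormedAddCommGroup F] [NormedSpace ℝ F]

theorem absolutelyContinuousOnInterval_of_dist_le {Y Z : Type*} [PseudoMetricSpace Y]
    [PseudoMetricSpace Z] {g : ℝ → Z} {h : ℝ → Y} {a b : ℝ} {C : ℝ≥0}
    (hg : AbsolutelyContinuousOnInterval g a b)
    (hle : ∀ s ∈ uIcc a b, ∀ t ∈ uIcc a b, dist (h s) (h t) ≤ C * dist (g s) (g t)) :
    AbsolutelyContinuousOnInterval h a b := by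
  rw [absolutelyContinuousOnInterval_iff] at hg ⊢
  intro ε hε
  obtain ⟨δ, hδ, hsum⟩ := hg (ε / (C + 1)) (by positivity)
  refine ⟨δ, hδ, fun A hA hlt => ?_⟩
  calc ∑ i ∈ Finset.range A.1, dist (h (A.2 i).1) (h (A.2 i).2)
      ≤ ∑ i ∈ Finset.range A.1, (C + 1) * dist (g (A.2 i).1) (g (A.2 i).2) := by
        refine Finset.sum_le_sum fun i hi => ?_
        refine (hle _ (hA.1 i hi).1 _ (hA.1 i hi).2).trans ?_
        gcongr
        exact le_add_of_nonneg_right zero_le_one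
    _ = (C + 1) * ∑ i ∈ Finset.range A.1, dist (g (A.2 i).1) (g (A.2 i).2) := by
        rw [Finset.mul_sum]
    _ < (C + 1) * (ε / (C + 1)) := by gcongr; exact hsum A hA hlt
    _ = ε := by field_simp

theorem integral_eq_sub_of_forall_dual [CompleteSpace F] {h g : ℝ → F} {a b : ℝ}
    (hac : ∀ l : F →L[ℝ] ℝ, AbsolutelyContinuousOnInterval (fun t => l (h t)) a b)
    (hder : ∀ᵐ t : ℝ, t ∈ uIoc a b → HasDerivAt h (g t) t)
    (hg : IntervalIntegrable g volume a b) : ∫ t in a..b, g t = h b - h a := by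
  refine (SeparatingDual.eq_iff_forall_dual_eq (R := ℝ)).2 fun l => ?_
  have hderiv : ∫ t in a..b, l (g t) = ∫ t in a..b, deriv (fun t => l (h t)) t := by
    refine intervalIntegral.integral_congr_ae ?_
    filter_upwards [hder] with t ht htm
    exact (l.hasFDerivAt.comp_hasDerivAt t (ht htm)).deriv.symm
  rw [← l.intervalIntegral_comp_comm hg, hderiv, (hac l).integral_deriv_eq_sub, map_sub]

theorem norm_sub_le_of_ae_hasDerivAt {h h' : ℝ → F} {K : ℝ≥0} (hh : LipschitzWith K h)
    {a b L : ℝ} (hder : ∀ᵐ t : ℝ, t ∈ uIoc a b → HasDerivAt h (h' t) t ∧ ‖h' t‖ ≤ L) :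
    ‖h b - h a‖ ≤ L * |b - a| := by
  obtain ⟨l, hl, hl_eq⟩ := exists_dual_vector'' ℝ (h b - h a)
  have hac : AbsolutelyContinuousOnInterval (fun t => l (h t)) a b :=
    ((l.lipschitz.comp hh).lipschitzOnWith (s := uIcc a b)).absolutelyContinuousOnInterval
  have hbound : ∀ᵐ t : ℝ, t ∈ uIoc a b → ‖deriv (fun t => l (h t)) t‖ ≤ L := by
    filter_upwards [hder] with t ht htm
    obtain ⟨htd, htL⟩ := ht htm
    have hlt : HasDerivAt (fun t => l (h t)) (l (h' t)) t :=
      l.hasFDerivAt.comp_hasDerivAt t htd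
    rw [hlt.deriv]
    exact (l.le_of_opNorm_le_of_le hl htL).trans_eq (one_mul L)
  have hint := intervalIntegral.norm_integral_le_of_norm_le_const_ae hbound
  rw [hac.integral_deriv_eq_sub, ← map_sub, hl_eq] at hint
  simpa using hint

variable {E : Type*} [NormedAddCommGroup E] [NormedSpace ℝ E] [FiniteDimensional ℝ E]
  [MeasurableSpace E] [BorelSpace E] {μ : Measure E} [μ.IsAddHaarMeasure]

theorem ae_ae_add_smul {p : E → Prop} (hp : ∀ᵐ x ∂μ, p x) (v : E) :
    ∀ᵐ x ∂μ, ∀ᵐ t : ℝ, p (x + t • v) := by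
  obtain ⟨N, hpN, hN, hN0⟩ := exists_measurable_superset_of_null hp
  have hNae : ∀ᵐ x ∂μ, x ∈ Nᶜ := by rw [ae_iff]; simpa using hN0
  filter_upwards [(ae_ae_add_linearMap_mem_iff (LinearMap.toSpanSingleton ℝ E v) volume μ
    hN.compl).2 hNae] with x hx
  filter_upwards [hx] with t ht
  exact not_not.1 fun hpt => ht (hpN hpt)

/-- By Rademacher's theorem and Fubini's theorem, the function is differentiable at almost all
points of almost every line in a given direction. -/
theorem lipschitzOnWith_of_ae_norm_fderiv_le [FiniteDimensional ℝ F] {f : E → F} {K L : ℝ≥0}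
    (hf : LipschitzWith K f) {U : Set E} (hU : IsOpen U) (hUc : Convex ℝ U)
    (hL : ∀ᵐ x ∂μ, x ∈ U → ‖fderiv ℝ f x‖ ≤ L) : LipschitzOnWith L f U := by
  have htranslate : ∀ v : E, ∀ᵐ z ∂μ, z ∈ U → z + v ∈ U → ‖f (z + v) - f z‖ ≤ L * ‖v‖ := by
    intro v
    filter_upwards [ae_ae_add_smul ((hf.ae_differentiableAt (μ := μ)).and hL) v] with z hz hzU hzvU
    have hline : ∀ t : ℝ, HasDerivAt (fun t : ℝ => z + t • v) v t := fun t => by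
      simpa using ((hasDerivAt_id t).smul_const v).const_add z
    have hlip : LipschitzWith (K * ‖v‖₊) fun t : ℝ => f (z + t • v) := by
      refine hf.comp (LipschitzWith.of_dist_le_mul fun s t => ?_)
      rw [dist_add_left, dist_eq_norm, ← sub_smul, norm_smul, dist_eq_norm, coe_nnnorm, mul_comm]
    have hder : ∀ᵐ t : ℝ, t ∈ uIoc 0 1 → HasDerivAt (fun t : ℝ => f (z + t • v))
        (fderiv ℝ f (z + t • v) v) t ∧ ‖fderiv ℝ f (z + t • v) v‖ ≤ L * ‖v‖ := by
      filter_upwards [hz] with t ht htm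
      rw [uIoc_of_le zero_le_one] at htm
      have hmem : z + t • v ∈ U := by
        simpa using hUc.add_smul_sub_mem hzU hzvU ⟨htm.1.le, htm.2⟩
      exact ⟨ht.1.hasFDerivAt.comp_hasDerivAt t (hline t),
        (fderiv ℝ f _).le_of_opNorm_le (ht.2 hmem) v⟩
    simpa using norm_sub_le_of_ae_hasDerivAt hlip hder
  refine LipschitzOnWith.of_dist_le_mul fun x hx y hy => ?_
  have hdense : y ∈ closure {z | z ∈ U → z + (x - y) ∈ U →
      ‖f (z + (x - y)) - f z‖ ≤ L * ‖x - y‖} := Measure.dense_of_ae (htranslate (x - y)) y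
  have hnear : ∀ᶠ z in 𝓝 y, z ∈ U ∧ z + (x - y) ∈ U :=
    (hU.inter (hU.preimage (continuous_add_const (x - y)))).mem_nhds ⟨hy, by simpa using hx⟩
  have hclosed : IsClosed {z | ‖f (z + (x - y)) - f z‖ ≤ L * ‖x - y‖} := by
    have := hf.continuous
    exact isClosed_le (by fun_prop) continuous_const
  have hmem : y ∈ {z | ‖f (z + (x - y)) - f z‖ ≤ L * ‖x - y‖} :=
    hclosed.mem_of_frequently_of_tendsto
      ((mem_closure_iff_frequently.1 hdense).and_eventually hnear |>.mono
        fun z hz => hz.1 hz.2.1 hz.2.2) tendsto_id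
  simpa [dist_eq_norm] using hmem

end Calculus

/-! ### Carathéodory differential equations in a finite-dimensional space -/

section Caratheodory

variable {F : Type*} [NormedAddCommGroup F]

theorem intervalIntegrable_of_integrableOn_uIcc {g : ℝ → F} {a b s t : ℝ}
    (hg : IntegrableOn g (uIcc a b)) (hs : s ∈ uIcc a b) (ht : t ∈ uIcc a b) :
    IntervalIntegrable g volume s t :=
  (hg.mono_set (uIcc_subset_uIcc hs ht)).intervalIntegrable

theorem norm_intervalIntegral_le_setIntegral [NormedSpace ℝ F] {g : ℝ → F} {k : ℝ → ℝ}
    {a b s t : ℝ} (hs : s ∈ uIcc a b) (ht : t ∈ uIcc a b) (hk : IntegrableOn k (uIcc a b))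
    (hle : ∀ᵐ r ∂volume.restrict (uIcc a b), ‖g r‖ ≤ k r) :
    ‖∫ r in s..t, g r‖ ≤ ∫ r in uIcc a b, k r := by
  have hsub : uIoc s t ⊆ uIcc a b := uIoc_subset_uIcc.trans (uIcc_subset_uIcc hs ht)
  rw [intervalIntegral.norm_integral_eq_norm_integral_uIoc]
  calc ‖∫ r in uIoc s t, g r‖ ≤ ∫ r in uIoc s t, k r :=
        norm_integral_le_of_norm_le (hk.mono_set hsub)
          (ae_restrict_of_ae_restrict_of_subset hsub hle)
    _ ≤ ∫ r in uIcc a b, k r := by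
        refine setIntegral_mono_set hk ?_ hsub.eventuallyLE
        filter_upwards [hle] with r hr using (norm_nonneg _).trans hr

theorem aestronglyMeasurable_comp_of_continuousOn {α X : Type*} [MeasurableSpace α] [Nonempty α]
    [PseudoEMetricSpace X] [MeasurableSpace X] [OpensMeasurableSpace X]
    [TopologicalSpace.SeparableSpace X] {ν : Measure α} {f : α → X → F} {B : Set X} {u : α → X}
    (hmeas : ∀ x ∈ B, AEStronglyMeasurable (fun t => f t x) ν)
    (hcont : ∀ᵐ t ∂ν, ContinuousOn (f t) B) (hu : Measurable u) (huB : ∀ t, u t ∈ B) :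
    AEStronglyMeasurable (fun t => f t (u t)) ν := by
  obtain ⟨t₀⟩ := ‹Nonempty α›
  let s : ℕ → SimpleFunc α X := SimpleFunc.approxOn u hu B (u t₀) (huB t₀)
  have hs : ∀ n t, s n t ∈ B := fun n t => SimpleFunc.approxOn_mem hu (huB t₀) n t
  refine aestronglyMeasurable_of_tendsto_ae atTop (f := fun n t => f t (s n t)) (fun n => ?_) ?_
  · have hsum : (fun t => f t (s n t))
        = fun t => ∑ y ∈ (s n).range, (s n ⁻¹' {y}).indicator (fun t => f t y) t := by
      funext t
      rw [Finset.sum_eq_single_of_mem (s n t) ((s n).mem_range_self t)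
        fun y _ hy => indicator_of_notMem (fun h => hy h.symm) _]
      exact (indicator_of_mem (mem_singleton (s n t)) _).symm
    rw [hsum]
    refine Finset.aestronglyMeasurable_fun_sum _ fun y hy => ?_
    obtain ⟨t, rfl⟩ := SimpleFunc.mem_range.1 hy
    exact (hmeas _ (hs n t)).indicator ((s n).measurableSet_fiber _)
  · filter_upwards [hcont] with t ht
    have hst : Tendsto (fun n => s n t) atTop (𝓝[B] (u t)) :=
      tendsto_nhdsWithin_iff.2 ⟨SimpleFunc.tendsto_approxOn hu (huB t₀) (subset_closure (huB t)),
        Eventually.of_forall fun n => hs n t⟩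
    exact (ht (u t) (huB t)).tendsto.comp hst

variable {E : Type*} [NormedAddCommGroup E]

/-- Carathéodory's conditions on the right-hand side of an ordinary differential equation: `f` is
measurable in time and, for almost every `t ∈ I`, the map `f t` is bounded by `m t` and
`m t`-Lipschitz on `B`, where `m` is integrable on `I`. A single majorant `m` serves for both
bounds. -/
structure IsCaratheodoryOn (f : ℝ → E → E) (m : ℝ → ℝ≥0) (B : Set E) (I : Set ℝ) : Prop where
  measurable : ∀ x ∈ B, AEStronglyMeasurable (fun t => f t x) (volume.restrict I)
  integrable : IntegrableOn (fun t => (m t : ℝ)) I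
  bound : ∀ᵐ t ∂volume.restrict I, ∀ x ∈ B, ‖f t x‖ ≤ m t
  lipschitz : ∀ᵐ t ∂volume.restrict I, LipschitzOnWith (m t) (f t) B

/-- `u` solves the differential equation `u' = f t u` on the interval with end points `a` and `b`,
in its integral form, and stays in `B`. -/
structure IsIntegralSolution [NormedSpace ℝ E] (f : ℝ → E → E) (B : Set E) (a b : ℝ)
    (u : ℝ → E) : Prop where
  continuousOn : ContinuousOn u (uIcc a b)
  mapsTo : MapsTo u (uIcc a b) B
  eq_integral : ∀ t ∈ uIcc a b, u t = u a + ∫ s in a..t, f s (u s)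

variable {f g : ℝ → E → E} {m m' : ℝ → ℝ≥0} {n : ℝ → ℝ} {B : Set E} {I J : Set ℝ} {a b : ℝ}
  {u v : ℝ → E}

theorem IsCaratheodoryOn.mono (hf : IsCaratheodoryOn f m B I) (h : J ⊆ I) :
    IsCaratheodoryOn f m B J where
  measurable x hx := (hf.measurable x hx).mono_measure (Measure.restrict_mono_set _ h)
  integrable := hf.integrable.mono_set h
  bound := ae_restrict_of_ae_restrict_of_subset h hf.bound
  lipschitz := ae_restrict_of_ae_restrict_of_subset h hf.lipschitz

theorem IsCaratheodoryOn.setIntegral_mono (hf : IsCaratheodoryOn f m B I) (h : J ⊆ I) :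
    ∫ t in J, (m t : ℝ) ≤ ∫ t in I, (m t : ℝ) :=
  setIntegral_mono_set hf.integrable (ae_of_all _ fun _ => NNReal.coe_nonneg _) h.eventuallyLE

theorem IsCaratheodoryOn.add (hf : IsCaratheodoryOn f m B I) (hg : IsCaratheodoryOn g m' B I) :
    IsCaratheodoryOn (f + g) (m + m') B I where
  measurable x hx := (hf.measurable x hx).add (hg.measurable x hx)
  integrable := by simpa using! Integrable.add hf.integrable hg.integrable
  bound := by
    filter_upwards [hf.bound, hg.bound] with t hft hgt x hx
    exact norm_add_le_of_le (hft x hx) (hgt x hx)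
  lipschitz := by
    filter_upwards [hf.lipschitz, hg.lipschitz] with t hft hgt using hft.add hgt

variable [NormedSpace ℝ E]

theorem IsCaratheodoryOn.norm_integral_le (hf : IsCaratheodoryOn f m B (uIcc a b))
    (huB : MapsTo u (uIcc a b) B) {t : ℝ} (ht : t ∈ uIcc a b) :
    ‖∫ s in a..t, f s (u s)‖ ≤ ∫ s in uIcc a b, (m s : ℝ) := by
  refine norm_intervalIntegral_le_setIntegral left_mem_uIcc ht hf.integrable ?_
  filter_upwards [hf.bound, ae_restrict_mem measurableSet_uIcc] with s hs hsI
  exact hs _ (huB hsI)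

variable [FiniteDimensional ℝ E]

theorem IsCaratheodoryOn.integrableOn_comp (hf : IsCaratheodoryOn f m B (uIcc a b))
    (hu : ContinuousOn u (uIcc a b)) (huB : MapsTo u (uIcc a b) B) :
    IntegrableOn (fun t => f t (u t)) (uIcc a b) := by
  borelize E
  have hle : min a b ≤ max a b := min_le_max
  let w : ℝ → E := IccExtend hle ((uIcc a b).domRestrict u)
  have hw : Continuous w := (continuousOn_iff_continuous_domRestrict.1 hu).Icc_extend'
  have hwu : EqOn w u (uIcc a b) := fun t ht => IccExtend_of_mem hle _ ht
  have hwB : ∀ t, w t ∈ B := fun t => huB (projIcc _ _ hle t).2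
  have hmeas : AEStronglyMeasurable (fun t => f t (w t)) (volume.restrict (uIcc a b)) :=
    aestronglyMeasurable_comp_of_continuousOn hf.measurable
      (hf.lipschitz.mono fun _ ht => ht.continuousOn) hw.measurable hwB
  have hint : IntegrableOn (fun t => f t (w t)) (uIcc a b) :=
    Integrable.mono' hf.integrable hmeas (hf.bound.mono fun t ht => ht _ (hwB t))
  exact hint.congr_fun (fun t ht => by simp only [hwu ht]) measurableSet_uIcc

theorem IsCaratheodoryOn.continuousOn_integral (hf : IsCaratheodoryOn f m B (uIcc a b))
    (hu : ContinuousOn u (uIcc a b)) (huB : MapsTo u (uIcc a b) B) :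
    ContinuousOn (fun t => ∫ s in a..t, f s (u s)) (uIcc a b) :=
  intervalIntegral.continuousOn_primitive_interval' (intervalIntegrable_of_integrableOn_uIcc
    (hf.integrableOn_comp hu huB) left_mem_uIcc right_mem_uIcc) left_mem_uIcc

theorem IsCaratheodoryOn.norm_integral_sub_integral_le (hf : IsCaratheodoryOn f m B (uIcc a b))
    (hg : IsCaratheodoryOn g m' B (uIcc a b)) (hn : IntegrableOn n (uIcc a b))
    (hfg : ∀ᵐ t ∂volume.restrict (uIcc a b), ∀ x ∈ B, ‖f t x - g t x‖ ≤ n t)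
    (hu : ContinuousOn u (uIcc a b)) (huB : MapsTo u (uIcc a b) B)
    (hv : ContinuousOn v (uIcc a b)) (hvB : MapsTo v (uIcc a b) B)
    {D : ℝ} (huv : ∀ t ∈ uIcc a b, ‖u t - v t‖ ≤ D) {t : ℝ} (ht : t ∈ uIcc a b) :
    ‖(∫ s in a..t, f s (u s)) - ∫ s in a..t, g s (v s)‖
      ≤ (∫ s in uIcc a b, (m s : ℝ)) * D + ∫ s in uIcc a b, n s := by
  rw [← integral_mul_const, ← integral_add (hf.integrable.mul_const D) hn,
    ← intervalIntegral.integral_sub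
      (intervalIntegrable_of_integrableOn_uIcc (hf.integrableOn_comp hu huB) left_mem_uIcc ht)
      (intervalIntegrable_of_integrableOn_uIcc (hg.integrableOn_comp hv hvB) left_mem_uIcc ht)]
  refine norm_intervalIntegral_le_setIntegral left_mem_uIcc ht
    ((hf.integrable.mul_const D).add hn) ?_
  filter_upwards [hf.lipschitz, hfg, ae_restrict_mem measurableSet_uIcc] with s hlip hs hsI
  calc ‖f s (u s) - g s (v s)‖
      ≤ ‖f s (u s) - f s (v s)‖ + ‖f s (v s) - g s (v s)‖ := norm_sub_le_norm_sub_add_norm_sub ..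
    _ ≤ m s * D + n s := by
      gcongr
      · exact (hlip.norm_sub_le (huB hsI) (hvB hsI)).trans (by gcongr; exact huv s hsI)
      · exact hs _ (hvB hsI)

theorem IsIntegralSolution.sub_eq_integral (hu : IsIntegralSolution f B a b u)
    (hf : IsCaratheodoryOn f m B (uIcc a b)) {s t : ℝ} (hs : s ∈ uIcc a b) (ht : t ∈ uIcc a b) :
    u t - u s = ∫ r in s..t, f r (u r) := by
  have hint := fun t => intervalIntegrable_of_integrableOn_uIcc (t := t)
    (hf.integrableOn_comp hu.continuousOn hu.mapsTo) left_mem_uIcc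
  rw [hu.eq_integral s hs, hu.eq_integral t ht, add_sub_add_left_eq_sub,
    intervalIntegral.integral_interval_sub_left (hint t ht) (hint s hs)]

theorem IsIntegralSolution.mono (hu : IsIntegralSolution f B a b u)
    (hf : IsCaratheodoryOn f m B (uIcc a b)) {s t : ℝ} (hs : s ∈ uIcc a b) (ht : t ∈ uIcc a b) :
    IsIntegralSolution f B s t u where
  continuousOn := hu.continuousOn.mono (uIcc_subset_uIcc hs ht)
  mapsTo := hu.mapsTo.mono_left (uIcc_subset_uIcc hs ht)
  eq_integral r hr := by
    rw [← hu.sub_eq_integral hf hs (uIcc_subset_uIcc hs ht hr), add_sub_cancel]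

theorem IsIntegralSolution.absolutelyContinuousOnInterval (hu : IsIntegralSolution f B a b u)
    (hf : IsCaratheodoryOn f m B (uIcc a b)) : AbsolutelyContinuousOnInterval u a b := by
  have hint := fun t => intervalIntegrable_of_integrableOn_uIcc (t := t)
    (hf.integrableOn_comp hu.continuousOn hu.mapsTo).norm left_mem_uIcc
  refine absolutelyContinuousOnInterval_of_dist_le (C := 1)
    ((hint b right_mem_uIcc).absolutelyContinuousOnInterval_intervalIntegral left_mem_uIcc)
    fun s hs t ht => ?_
  rw [dist_comm, dist_comm (∫ r in a..s, _), dist_eq_norm, Real.dist_eq,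
    intervalIntegral.integral_interval_sub_left (hint t ht) (hint s hs),
    hu.sub_eq_integral hf hs ht, NNReal.coe_one, one_mul]
  exact intervalIntegral.norm_integral_le_abs_integral_norm

theorem IsIntegralSolution.norm_sub_le (hf : IsCaratheodoryOn f m B (uIcc a b))
    (hg : IsCaratheodoryOn g m' B (uIcc a b)) (hm : ∫ t in uIcc a b, (m t : ℝ) ≤ 1 / 2)
    (hn : IntegrableOn n (uIcc a b))
    (hfg : ∀ᵐ t ∂volume.restrict (uIcc a b), ∀ x ∈ B, ‖f t x - g t x‖ ≤ n t)
    (hu : IsIntegralSolution f B a b u) (hv : IsIntegralSolution g B a b v)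
    {t : ℝ} (ht : t ∈ uIcc a b) :
    ‖u t - v t‖ ≤ 2 * (‖u a - v a‖ + ∫ s in uIcc a b, n s) := by
  obtain ⟨τ, hτ, hmax⟩ := isCompact_uIcc.exists_isMaxOn (nonempty_uIcc (a := a) (b := b))
    (hu.continuousOn.sub hv.continuousOn).norm
  have hle : ∀ s ∈ uIcc a b, ‖u s - v s‖ ≤ ‖u τ - v τ‖ := fun s hs => hmax hs
  have hint := hf.norm_integral_sub_integral_le hg hn hfg hu.continuousOn hu.mapsTo
    hv.continuousOn hv.mapsTo hle hτ
  have hmul := mul_le_mul_of_nonneg_right hm (norm_nonneg (u τ - v τ))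
  have hmaxval : ‖u τ - v τ‖ ≤ ‖u a - v a‖
      + ‖(∫ s in a..τ, f s (u s)) - ∫ s in a..τ, g s (v s)‖ := by
    conv_lhs => rw [hu.eq_integral τ hτ, hv.eq_integral τ hτ, add_sub_add_comm]
    exact norm_add_le _ _
  linarith [hle t ht]

theorem IsIntegralSolution.eqOn (hf : IsCaratheodoryOn f m B (uIcc a b))
    (hm : ∫ t in uIcc a b, (m t : ℝ) ≤ 1 / 2) (hu : IsIntegralSolution f B a b u)
    (hv : IsIntegralSolution f B a b v) (huv : u a = v a) : EqOn u v (uIcc a b) := by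
  intro t ht
  have hle := hu.norm_sub_le hf hf hm (integrableOn_zero (ε' := ℝ)) (by simp) hv ht
  rw [huv, sub_self, norm_zero, integral_zero, add_zero, mul_zero] at hle
  exact eq_of_norm_sub_le_zero hle

theorem IsCaratheodoryOn.exists_isIntegralSolution (hf : IsCaratheodoryOn f m B (uIcc a b))
    (hB : IsClosed B) (hm : ∫ t in uIcc a b, (m t : ℝ) ≤ 1 / 2) {x : E}
    (hxB : Metric.closedBall x (∫ t in uIcc a b, (m t : ℝ)) ⊆ B) :
    ∃ u, IsIntegralSolution f B a b u ∧ u a = x := by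
  have hle : min a b ≤ max a b := min_le_max
  have : CompactSpace (uIcc a b) := isCompact_iff_compactSpace.1 isCompact_uIcc
  let Z : Set C(uIcc a b, E) := {u | ∀ t, u t ∈ B}
  let ext : C(uIcc a b, E) → ℝ → E := fun u => IccExtend hle u
  have hext : ∀ u : C(uIcc a b, E), ContinuousOn (ext u) (uIcc a b) := fun u =>
    u.continuous.Icc_extend'.continuousOn
  have hextB : ∀ u ∈ Z, MapsTo (ext u) (uIcc a b) B := fun u hu t _ => hu (projIcc _ _ hle t)
  have hpicard : ∀ u ∈ Z, Continuous fun t : uIcc a b => x + ∫ s in a..t, f s (ext u s) :=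
    fun u hu => continuous_const.add <| continuousOn_iff_continuous_domRestrict.1 <|
      hf.continuousOn_integral (hext u) (hextB u hu)
  have hpicardB : ∀ u ∈ Z, ∀ t : uIcc a b, x + ∫ s in a..t, f s (ext u s) ∈ B := by
    refine fun u hu t => hxB ?_
    rw [mem_closedBall_iff_norm, add_sub_cancel_left]
    exact hf.norm_integral_le (hextB u hu) t.2
  let picard : Z → Z := fun u => ⟨⟨_, hpicard u u.2⟩, hpicardB u u.2⟩
  have hcontracting : ContractingWith (1 / 2) picard := by
    refine ⟨by norm_num, LipschitzWith.of_dist_le_mul fun u v => ?_⟩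
    refine (ContinuousMap.dist_le (by positivity)).2 fun t => ?_
    have h := hf.norm_integral_sub_integral_le hf (integrableOn_zero (ε' := ℝ))
      (by simp) (hext u) (hextB u u.2) (hext v) (hextB v v.2) (D := dist u v)
      (fun s _ => by
        rw [← dist_eq_norm]; exact ContinuousMap.dist_apply_le_dist (projIcc _ _ hle s)) t.2
    rw [integral_zero, add_zero, ← dist_eq_norm] at h
    refine (dist_add_left x _ _).trans_le (h.trans ?_)
    gcongr
    simpa using hm
  have hx : x ∈ B := hxB (Metric.mem_closedBall_self (integral_nonneg fun _ => NNReal.coe_nonneg _))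
  have : Nonempty Z := ⟨⟨ContinuousMap.const _ x, fun _ => hx⟩⟩
  have hZ : IsClosed Z := by
    simp only [Z, ofPred_forall]
    exact isClosed_iInter fun t => hB.preimage (by fun_prop)
  have : CompleteSpace Z := hZ.completeSpace_coe
  let u := hcontracting.fixedPoint picard
  have hu : ∀ t ∈ uIcc a b, ext u t = x + ∫ s in a..t, f s (ext u s) := fun t ht =>
    (IccExtend_of_mem hle _ ht).trans <|
      congrArg (fun w : Z => w.1 ⟨t, ht⟩) hcontracting.fixedPoint_isFixedPt.symm
  have hua : ext u a = x := by simpa using hu a left_mem_uIcc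
  exact ⟨ext u, ⟨hext u, hextB u u.2, fun t ht => hua ▸ hu t ht⟩, hua⟩

end Caratheodory

/-! ### Vector fields and connections in charts -/

section Charts

variable {E : Type*} [NormedAddCommGroup E] [NormedSpace ℝ E]
  {M : Type*} [TopologicalSpace M] [ChartedSpace E M] [IsManifold 𝓘(ℝ, E) ∞ M]

/-- The differential at `y` of the chart at `z`, defined through the trivialization of the tangent
bundle at `z` and hence linear for every `y`, but meaningful only for `y` in the domain of the
chart. -/
def chartDeriv (z y : M) : TangentSpace 𝓘(ℝ, E) y →L[ℝ] E :=
  (trivializationAt E (TangentSpace 𝓘(ℝ, E)) z).continuousLinearMapAt ℝ y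

/-- The inverse of the differential at `y` of the chart at `z`. -/
def chartDerivSymm (z y : M) : E →L[ℝ] TangentSpace 𝓘(ℝ, E) y :=
  (trivializationAt E (TangentSpace 𝓘(ℝ, E)) z).symmL ℝ y

/-- The expression of a vector field in the chart at `z`, as a function on `M`. -/
def localRep (z : M) (ξ : (x : M) → TangentSpace 𝓘(ℝ, E) x) (y : M) : E := chartDeriv z y (ξ y)

/-- The expression of `∇ξ` in the chart at `z`, as a function on `M`. -/
def nablaRep (nabla : CovariantDerivative 𝓘(ℝ, E) E (fun x : M => TangentSpace 𝓘(ℝ, E) x)) (z : M)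
    (ξ : (x : M) → TangentSpace 𝓘(ℝ, E) x) (y : M) : E →L[ℝ] E :=
  chartDeriv z y ∘L nabla ξ y ∘L chartDerivSymm z y

/-- The flat connection of the chart at `z`. -/
def flatConnection (z : M) (ξ : (x : M) → TangentSpace 𝓘(ℝ, E) x) (y : M) :
    TangentSpace 𝓘(ℝ, E) y →L[ℝ] TangentSpace 𝓘(ℝ, E) y :=
  chartDerivSymm z y ∘L mvfderiv 𝓘(ℝ, E) (localRep z ξ) y

variable {z y : M} {ξ : (x : M) → TangentSpace 𝓘(ℝ, E) x}

theorem chartDeriv_apply (hy : y ∈ (chartAt E z).source) (v : TangentSpace 𝓘(ℝ, E) y) :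
    chartDeriv z y v = (trivializationAt E (TangentSpace 𝓘(ℝ, E)) z ⟨y, v⟩).2 := by
  rw [chartDeriv, Trivialization.continuousLinearMapAt_apply,
    Trivialization.coe_linearMapAt_of_mem _ (by simpa using hy)]

theorem chartDerivSymm_chartDeriv (hy : y ∈ (chartAt E z).source)
    (v : TangentSpace 𝓘(ℝ, E) y) : chartDerivSymm z y (chartDeriv z y v) = v :=
  (trivializationAt E (TangentSpace 𝓘(ℝ, E)) z).symmL_continuousLinearMapAt (by simpa using hy) v

theorem chartDeriv_chartDerivSymm (hy : y ∈ (chartAt E z).source) (v : E) :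
    chartDeriv z y (chartDerivSymm z y v) = v :=
  (trivializationAt E (TangentSpace 𝓘(ℝ, E)) z).continuousLinearMapAt_symmL (by simpa using hy) v

theorem chartDeriv_eq_mfderiv (hy : y ∈ (chartAt E z).source) :
    chartDeriv (E := E) z y = mfderiv% (extChartAt 𝓘(ℝ, E) z) y :=
  TangentBundle.continuousLinearMapAt_trivializationAt (E := E) (I := 𝓘(ℝ, E)) (𝕜 := ℝ) hy

theorem chartDerivSymm_eq_mfderiv (hy : y ∈ (chartAt E z).source) :
    chartDerivSymm (E := E) z y =
      mfderiv% (extChartAt 𝓘(ℝ, E) z).symm (extChartAt 𝓘(ℝ, E) z y) := by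
  have h := TangentBundle.symmL_trivializationAt (E := E) (I := 𝓘(ℝ, E)) (𝕜 := ℝ) hy
  simp only [modelWithCornersSelf_coe, range_id, mfderivWithin_univ] at h
  exact h

theorem localRep_sub (z : M) (ξ η : (x : M) → TangentSpace 𝓘(ℝ, E) x) (y : M) :
    localRep z (ξ - η) y = localRep z ξ y - localRep z η y :=
  map_sub (chartDeriv z y) (ξ y) (η y)

theorem mdifferentiableAt_localRep_iff (hy : y ∈ (chartAt E z).source) :
    MDiffAt (localRep z ξ) y ↔ MDiffAt (T% ξ) y := by
  rw [(trivializationAt E (TangentSpace 𝓘(ℝ, E)) z).mdifferentiableAt_section_iff 𝓘(ℝ, E) ξ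
    (by simpa using hy)]
  refine EventuallyEq.mdifferentiableAt_iff ?_
  filter_upwards [(chartAt E z).open_source.mem_nhds hy] with x hx
  exact chartDeriv_apply hx _

theorem isCovariantDerivativeOn_flatConnection (z : M) :
    IsCovariantDerivativeOn E (flatConnection (E := E) z) (chartAt E z).source where
  add {ξ η y} hξ hη hy := by
    rw [← mdifferentiableAt_localRep_iff hy] at hξ hη
    have hadd : localRep z (ξ + η) = localRep z ξ + localRep z η :=
      funext fun x => map_add (chartDeriv z x) (ξ x) (η x)
    rw [flatConnection, hadd, mvfderiv_add hξ hη, ContinuousLinearMap.comp_add]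
    rfl
  leibniz {ξ g y} hξ hg hy := by
    rw [← mdifferentiableAt_localRep_iff hy] at hξ
    have hsmul : localRep z (g • ξ) = g • localRep z ξ :=
      funext fun x => map_smul (chartDeriv z x) (g x) (ξ x)
    ext v
    rw [flatConnection, hsmul, mvfderiv_smul hg hξ]
    simp [flatConnection, localRep, chartDerivSymm_chartDeriv hy]

variable {nabla : CovariantDerivative 𝓘(ℝ, E) E (fun x : M => TangentSpace 𝓘(ℝ, E) x)}

theorem continuousAt_nablaRep (hnabla : nabla.ContMDiffCovariantDerivative ∞) (z : M)
    (hξ : CMDiff ∞ (T% ξ)) : ContinuousAt (nablaRep nabla z ξ) z :=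
  have hsmooth := hnabla.contMDiff.contMDiff (σ := ξ) (by simpa using hξ.contMDiffOn)
  ((contMDiffAt_hom_bundle _).1 (hsmooth.contMDiffAt (x := z) univ_mem)).2.continuousAt

variable [FiniteDimensional ℝ E]

variable (nabla) in
/-- The Christoffel symbols of `nabla` in the chart at `z`: the expression in this chart of the
tensor by which `nabla` differs from the flat connection of the chart. -/
def christoffel (z y : M) : E →L[ℝ] E →L[ℝ] E :=
  let D := nabla.isCovariantDerivativeOn.difference (isCovariantDerivativeOn_flatConnection z) y
  LinearMap.toContinuousLinearMap
    { toFun := fun v => chartDeriv z y ∘L D (chartDerivSymm z y v) ∘L chartDerivSymm z y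
      map_add' := fun v w => by ext; simp
      map_smul' := fun c v => by ext; simp }

theorem nablaRep_eq_add_christoffel (hy : y ∈ (chartAt E z).source) (hξ : MDiffAt (T% ξ) y) :
    nablaRep nabla z ξ y = mvfderiv 𝓘(ℝ, E) (localRep z ξ) y ∘L chartDerivSymm z y
      + christoffel nabla z y (localRep z ξ y) := by
  have hdiff := IsCovariantDerivativeOn.difference_apply nabla.isCovariantDerivativeOn
    (isCovariantDerivativeOn_flatConnection z) hy hξ
  ext w
  simp [christoffel, localRep, chartDerivSymm_chartDeriv hy, hdiff, nablaRep, flatConnection,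
    chartDeriv_chartDerivSymm hy]

variable [T2Space M]

theorem exists_contMDiff_localRep_eq_const (z : M) (w : E) :
    ∃ σ : (x : M) → TangentSpace 𝓘(ℝ, E) x, CMDiff ∞ (T% σ) ∧ ∀ᶠ x in 𝓝 z, localRep z σ x = w := by
  let e := trivializationAt E (TangentSpace 𝓘(ℝ, E) : M → Type _) z
  let ρ : SmoothBumpFunction 𝓘(ℝ, E) z := Classical.arbitrary _
  have hbase : e.baseSet = (chartAt E z).source := TangentBundle.trivializationAt_baseSet z
  have hconst : CMDiff[e.baseSet] ∞ (T% fun x => e.symm x w) := by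
    rw [e.contMDiffOn_section_baseSet_iff]
    exact contMDiffOn_const.congr fun x hx => by rw [e.apply_mk_symm hx]
  refine ⟨(ρ : M → ℝ) • fun x => e.symm x w, ContMDiffOn.smul_section_of_tsupport
    ρ.contMDiff.contMDiffOn e.open_baseSet (hbase ▸ ρ.tsupport_subset_chartAt_source) hconst, ?_⟩
  filter_upwards [ρ.eventuallyEq_one, chart_source_mem_nhds E z] with x hρ hx
  simp only [localRep, Pi.smul_apply', hρ, Pi.one_apply, one_smul]
  rw [chartDeriv_apply hx, e.apply_mk_symm (hbase ▸ hx)]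

theorem exists_norm_christoffel_le (hnabla : nabla.ContMDiffCovariantDerivative ∞) (z : M) :
    ∃ C : ℝ≥0, ∀ᶠ y in 𝓝 z, ‖christoffel nabla z y‖ ≤ C := by
  have hbound : ∀ w : E, ∃ C : ℝ, ∀ᶠ y in 𝓝 z, ‖christoffel nabla z y w‖ < C := by
    intro w
    obtain ⟨σ, hσ, hσw⟩ := exists_contMDiff_localRep_eq_const z w
    refine ⟨‖nablaRep nabla z σ z‖ + 1, ?_⟩
    filter_upwards [hσw.eventually_nhds, chart_source_mem_nhds E z,
      (continuousAt_nablaRep hnabla z hσ).norm.eventually_lt_const (lt_add_one _)] with y hyw hy hlt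
    have hconst : localRep z σ =ᶠ[𝓝 y] fun _ => w := hyw
    have hderiv : mvfderiv 𝓘(ℝ, E) (localRep z σ) y = 0 := by
      rw [mvfderiv, hconst.mfderiv_eq]
      exact mvfderiv_const w
    rwa [nablaRep_eq_add_christoffel hy ((hσ y).mdifferentiableAt (by simp)), hderiv,
      ContinuousLinearMap.zero_comp, zero_add, hconst.self_of_nhds] at hlt
  let b := Module.finBasis ℝ E
  choose C hC using fun i => hbound (b i)
  obtain ⟨D, -, hD⟩ := b.exists_opNorm_le (F := E →L[ℝ] E)
  refine ⟨(D * ∑ i, |C i|).toNNReal, (eventually_all.2 hC).mono fun y hy => ?_⟩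
  refine (hD (Finset.sum_nonneg fun i _ => abs_nonneg _) fun i => ?_).trans (Real.le_coe_toNNReal _)
  exact ((hy i).le.trans (le_abs_self _)).trans
    (Finset.single_le_sum (f := fun i => |C i|) (fun i _ => abs_nonneg _) (Finset.mem_univ i))

end Charts

/-! ### The seminorms `p_K^lip` control the Lipschitz constants in charts -/

section LipschitzExtension

theorem lipschitzOnWith_closedBall_of_norm_fderiv_le {E F : Type*} [NormedAddCommGroup E]
    [NormedSpace ℝ E] [FiniteDimensional ℝ E] [NormedAddCommGroup F] [NormedSpace ℝ F]
    [FiniteDimensional ℝ F] {f : E → F} {c : E} {r : ℝ} {K L : ℝ≥0}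
    (hf : LipschitzOnWith K f (Metric.closedBall c r))
    (hL : ∀ x ∈ Metric.ball c r, DifferentiableAt ℝ f x → ‖fderiv ℝ f x‖ ≤ L) :
    LipschitzOnWith L f (Metric.closedBall c r) := by
  borelize E
  rcases eq_or_ne r 0 with rfl | hr
  · intro x hx y hy
    simp_all
  obtain ⟨g, hg, hfg⟩ := hf.extend_finite_dimension
  have hfderiv : ∀ x ∈ Metric.ball c r, ‖fderiv ℝ g x‖ ≤ L := by
    intro x hx
    have hloc : g =ᶠ[𝓝 x] f := by
      filter_upwards [Metric.isOpen_ball.mem_nhds hx] with y hy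
      exact (hfg (Metric.ball_subset_closedBall hy)).symm
    rw [hloc.fderiv_eq]
    by_cases hd : DifferentiableAt ℝ f x
    · exact hL x hx hd
    · simp [fderiv_zero_of_not_differentiableAt hd]
  have hball : LipschitzOnWith L g (Metric.ball c r) :=
    lipschitzOnWith_of_ae_norm_fderiv_le (μ := Measure.addHaar) hg Metric.isOpen_ball
      (convex_ball c r) (ae_of_all _ hfderiv)
  have hclosed := hball.closure hg.continuous.continuousOn
  rw [closure_ball c hr] at hclosed
  intro x hx y hy
  rw [hfg hx, hfg hy]
  exact hclosed hx hy

theorem exists_lipschitzOnWith_clm_apply {E F G : Type*} [NormedAddCommGroup E] [NormedSpace ℝ E]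
    [NormedAddCommGroup F] [NormedSpace ℝ F] [NormedAddCommGroup G] [NormedSpace ℝ G]
    {A : E → F →L[ℝ] G} {B : E → F} {u : E} {K : ℝ≥0} {U : Set E} (hA : ContDiffAt ℝ 1 A u)
    (hU : U ∈ 𝓝 u) (hB : LipschitzOnWith K B U) :
    ∃ L : ℝ≥0, ∃ V ∈ 𝓝 u, LipschitzOnWith L (fun v => A v (B v)) V := by
  have heval : ContDiffAt ℝ 1 (fun p : E × F => A p.1 p.2) (u, B u) :=
    (hA.comp (u, B u) contDiffAt_fst).clm_apply contDiffAt_snd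
  obtain ⟨L, V, hV, hL⟩ := heval.exists_lipschitzOnWith
  have hpair : ContinuousAt (fun v => (v, B v)) u :=
    continuousAt_id.prodMk (hB.continuousOn.continuousAt hU)
  exact ⟨L * max 1 K, _, inter_mem hU (hpair.preimage_mem_nhds hV),
    hL.comp ((LipschitzWith.id.lipschitzOnWith.prodMk hB).mono inter_subset_left) fun v hv => hv.2⟩

end LipschitzExtension

section ChartEstimate

variable {E : Type*} [NormedAddCommGroup E] [NormedSpace ℝ E]
  {M : Type*} [TopologicalSpace M] [ChartedSpace E M]

/-- The closed ball of radius `r` around `z` in the coordinates of the chart at `z`. -/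
def chartBall (z : M) (r : ℝ) : Set M :=
  (extChartAt 𝓘(ℝ, E) z).symm '' Metric.closedBall (extChartAt 𝓘(ℝ, E) z z) r

theorem isCompact_chartBall [FiniteDimensional ℝ E] {z : M} {r : ℝ}
    (hr : Metric.closedBall (extChartAt 𝓘(ℝ, E) z z) r ⊆ (extChartAt 𝓘(ℝ, E) z).target) :
    IsCompact (chartBall (E := E) z r) :=
  (isCompact_closedBall _ _).image_of_continuousOn ((continuousOn_extChartAt_symm z).mono hr)

theorem eventually_closedBall_extChartAt {z : M} {p : M → Prop} (hp : ∀ᶠ y in 𝓝 z, p y) :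
    ∀ᶠ r in 𝓝[>] (0 : ℝ), ∀ u ∈ Metric.closedBall (extChartAt 𝓘(ℝ, E) z z) r,
      u ∈ (extChartAt 𝓘(ℝ, E) z).target ∧ p ((extChartAt 𝓘(ℝ, E) z).symm u) := by
  have hsymm := (continuousAt_extChartAt_symm (I := 𝓘(ℝ, E)) z).tendsto
  rw [extChartAt_to_inv] at hsymm
  obtain ⟨R, hR, hball⟩ := Metric.eventually_nhds_iff_ball.1
    ((eventually_mem_set.2 (extChartAt_target_mem_nhds z)).and (hsymm.eventually hp))
  filter_upwards [Ioo_mem_nhdsGT hR] with r hr u hu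
  exact hball u (Metric.closedBall_subset_ball hr.2 hu)

theorem extChartAt_symm_mem_chart_source {z : M} {u : E}
    (hu : u ∈ (extChartAt 𝓘(ℝ, E) z).target) :
    (extChartAt 𝓘(ℝ, E) z).symm u ∈ (chartAt E z).source := by
  simpa using (extChartAt 𝓘(ℝ, E) z).map_target hu

variable [IsManifold 𝓘(ℝ, E) ∞ M]

/-- The expression of a vector field in the chart at `z`, as a function on the model space. -/
def chartRep (z : M) (ξ : (x : M) → TangentSpace 𝓘(ℝ, E) x) (u : E) : E :=
  localRep z ξ ((extChartAt 𝓘(ℝ, E) z).symm u)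

variable {z : M} {ξ η : (x : M) → TangentSpace 𝓘(ℝ, E) x} {u : E}

theorem contMDiffAt_extChartAt_symm (hu : u ∈ (extChartAt 𝓘(ℝ, E) z).target) :
    ContMDiffAt 𝓘(ℝ, E) 𝓘(ℝ, E) ∞ (extChartAt 𝓘(ℝ, E) z).symm u :=
  (contMDiffOn_extChartAt_symm z).contMDiffAt ((isOpen_extChartAt_target z).mem_nhds hu)

theorem mdifferentiableAt_localRep_of_chartRep (hu : u ∈ (extChartAt 𝓘(ℝ, E) z).target)
    (hξ : DifferentiableAt ℝ (chartRep z ξ) u) :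
    MDiffAt (localRep z ξ) ((extChartAt 𝓘(ℝ, E) z).symm u) := by
  set φ := extChartAt 𝓘(ℝ, E) z
  have hy := extChartAt_symm_mem_chart_source hu
  have hcongr : localRep z ξ =ᶠ[𝓝 (φ.symm u)] chartRep z ξ ∘ φ := by
    filter_upwards [extChartAt_source_mem_nhds' (φ.map_target hu)] with x hx
    exact congrArg (localRep z ξ) (φ.left_inv hx).symm
  rw [← φ.right_inv hu] at hξ
  exact (hξ.mdifferentiableAt.comp _ (mdifferentiableAt_extChartAt hy)).congr_of_eventuallyEq hcongr

theorem fderiv_chartRep (hu : u ∈ (extChartAt 𝓘(ℝ, E) z).target)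
    (hξ : MDiffAt (localRep z ξ) ((extChartAt 𝓘(ℝ, E) z).symm u)) :
    fderiv ℝ (chartRep z ξ) u =
      mvfderiv 𝓘(ℝ, E) (localRep z ξ) ((extChartAt 𝓘(ℝ, E) z).symm u) ∘L
        chartDerivSymm z ((extChartAt 𝓘(ℝ, E) z).symm u) := by
  have hsymm := (contMDiffAt_extChartAt_symm hu).mdifferentiableAt (by simp)
  have hderiv := chartDerivSymm_eq_mfderiv (extChartAt_symm_mem_chart_source hu)
  rw [(extChartAt 𝓘(ℝ, E) z).right_inv hu] at hderiv
  refine HasFDerivAt.fderiv (f := chartRep z ξ) ?_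
  rw [hderiv]
  exact (hξ.hasMFDerivAt.comp u hsymm.hasMFDerivAt).hasFDerivAt

theorem IsLipSection.sub (hξ : IsLipSection ξ) (hη : IsLipSection η) : IsLipSection (ξ - η) := by
  intro x
  obtain ⟨C, U, hU, hC⟩ := hξ x
  obtain ⟨D, V, hV, hD⟩ := hη x
  refine ⟨C + D, U ∩ V ∩ (chartAt E x).source, inter_mem (inter_mem hU hV)
    (chart_source_mem_nhds E x), fun y hy z hz => ?_⟩
  have hCyz := hC y hy.1.1 z hz.1.1
  have hDyz := hD y hy.1.2 z hz.1.2
  rw [← chartDeriv_apply hy.2, ← chartDeriv_apply hz.2] at hCyz hDyz ⊢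
  change ‖localRep x (ξ - η) y - localRep x (ξ - η) z‖ ≤ _
  rw [localRep_sub, localRep_sub, sub_sub_sub_comm, NNReal.coe_add, add_mul]
  exact (norm_sub_le _ _).trans (add_le_add hCyz hDyz)

theorem IsLipSection.exists_lipschitzOnWith_localRep (hξ : IsLipSection ξ) {g : E → M}
    (hg : ContMDiffAt 𝓘(ℝ, E) 𝓘(ℝ, E) 1 g u) :
    ∃ K : ℝ≥0, ∃ U ∈ 𝓝 u, LipschitzOnWith K (localRep (g u) ξ ∘ g) U := by
  set y := g u
  have hφg : ContMDiffAt 𝓘(ℝ, E) 𝓘(ℝ, E) 1 (extChartAt 𝓘(ℝ, E) y ∘ g) u :=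
    ContMDiffAt.comp u contMDiffAt_extChartAt hg
  obtain ⟨Kφ, Uφ, hUφ, hLφ⟩ := hφg.contDiffAt.exists_lipschitzOnWith
  obtain ⟨C, V, hV, hC⟩ := hξ y
  refine ⟨C * Kφ, _, inter_mem hUφ (hg.continuousAt.preimage_mem_nhds
    (inter_mem hV (chart_source_mem_nhds E y))), ?_⟩
  refine LipschitzOnWith.of_dist_le_mul fun v hv w hw => ?_
  have hvw := hC _ hv.2.1 _ hw.2.1
  rw [← chartDeriv_apply hv.2.2, ← chartDeriv_apply hw.2.2, ← dist_eq_norm, ← dist_eq_norm] at hvw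
  calc dist (localRep y ξ (g v)) (localRep y ξ (g w))
      ≤ C * dist (extChartAt 𝓘(ℝ, E) y (g v)) (extChartAt 𝓘(ℝ, E) y (g w)) := hvw
    _ ≤ C * (Kφ * dist v w) := by gcongr; exact hLφ.dist_le_mul v hv.1 w hw.1
    _ = ↑(C * Kφ) * dist v w := by rw [NNReal.coe_mul, mul_assoc]

theorem contMDiffAt_chartDeriv_comp_chartDerivSymm {x y : M} (hx : y ∈ (chartAt E x).source)
    (hz : y ∈ (chartAt E z).source) :
    ContMDiffAt 𝓘(ℝ, E) 𝓘(ℝ, E →L[ℝ] E) ∞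
      (fun y : M => (chartDeriv z y ∘L chartDerivSymm x y : E →L[ℝ] E)) y := by
  let e := trivializationAt E (TangentSpace 𝓘(ℝ, E) : M → Type _) x
  let e' := trivializationAt E (TangentSpace 𝓘(ℝ, E) : M → Type _) z
  have hmem : e.baseSet ∩ e'.baseSet ∈ 𝓝 y :=
    (e.open_baseSet.inter e'.open_baseSet).mem_nhds (by simpa [e, e'] using ⟨hx, hz⟩)
  refine ((contMDiffOn_coordChangeL (IB := 𝓘(ℝ, E)) e e').contMDiffAt hmem).congr_of_eventuallyEq ?_
  filter_upwards [hmem] with w hw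
  ext v
  rw [ContinuousLinearEquiv.coe_coe, e.coordChangeL_apply e' hw, ContinuousLinearMap.comp_apply,
    chartDeriv_apply (by simpa [e'] using hw.2), chartDerivSymm, Trivialization.symmL_apply _ hw.1]

theorem IsLipSection.locallyLipschitzOn_chartRep (hξ : IsLipSection ξ) (z : M) :
    LocallyLipschitzOn (extChartAt 𝓘(ℝ, E) z).target (chartRep z ξ) := by
  intro u hu
  have hsymm := contMDiffAt_extChartAt_symm hu
  have hsource := extChartAt_symm_mem_chart_source hu
  set ψ := (extChartAt 𝓘(ℝ, E) z).symm
  have hA := ((contMDiffAt_chartDeriv_comp_chartDerivSymm (mem_chart_source E (ψ u)) hsource).comp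
    u hsymm).contDiffAt
  obtain ⟨K, U, hU, hB⟩ := hξ.exists_lipschitzOnWith_localRep (hsymm.of_le (by simp))
  obtain ⟨L, V, hV, hAB⟩ := exists_lipschitzOnWith_clm_apply (hA.of_le (by simp)) hU hB
  refine ⟨L, _, mem_nhdsWithin_of_mem_nhds (inter_mem hV
    (hsymm.continuousAt.preimage_mem_nhds (chart_source_mem_nhds E (ψ u)))), ?_⟩
  have heq : ∀ v ∈ ψ ⁻¹' (chartAt E (ψ u)).source,
      chartDeriv z (ψ v) (chartDerivSymm (ψ u) (ψ v) (localRep (ψ u) ξ (ψ v))) = chartRep z ξ v :=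
    fun v hv => congrArg (chartDeriv z (ψ v)) (chartDerivSymm_chartDeriv hv (ξ (ψ v)))
  intro v hv w hw
  rw [← heq v hv.2, ← heq w hw.2]
  exact hAB hv.1 hw.1

variable [RiemannianBundle (fun x : M => TangentSpace 𝓘(ℝ, E) x)]
  {nabla : CovariantDerivative 𝓘(ℝ, E) E (fun x : M => TangentSpace 𝓘(ℝ, E) x)} {K : Set M} {y : M}

theorem norm_le_pLip (hfin : pLip nabla K ξ ≠ ⊤) (hy : y ∈ K) :
    ‖ξ y‖ ≤ (pLip nabla K ξ).toNNReal := by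
  have hle : ‖ξ y‖ₑ ≤ pLip nabla K ξ :=
    (le_iSup₂ (f := fun x (_ : x ∈ K) => ‖ξ x‖ₑ) y hy).trans (le_max_right _ _)
  exact NNReal.coe_le_coe.2 (ENNReal.toNNReal_mono hfin hle)

theorem norm_nabla_apply_le_pLip (hfin : pLip nabla K ξ ≠ ⊤) (hy : y ∈ K) (hξ : MDiffAt (T% ξ) y)
    (v : TangentSpace 𝓘(ℝ, E) y) : ‖nabla ξ y v‖ ≤ (pLip nabla K ξ).toNNReal * ‖v‖ := by
  have hunit : ∀ v : TangentSpace 𝓘(ℝ, E) y, ‖v‖ = 1 →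
      ‖nabla ξ y v‖ ≤ (pLip nabla K ξ).toNNReal := by
    intro v hv
    have hdil : ‖nabla ξ y v‖ₑ ≤ dil nabla ξ y :=
      le_iInf fun U => le_iInf fun hU => le_iInf fun _ => le_iSup_of_le y <|
        le_iSup_of_le (subset_closure (mem_of_mem_nhds hU)) <|
          le_iSup_of_le hξ <| le_iSup_of_le v <| le_iSup_of_le hv le_rfl
    have hle : ‖nabla ξ y v‖ₑ ≤ pLip nabla K ξ := hdil.trans <|
      (le_iSup₂ (f := fun x (_ : x ∈ K) => dil nabla ξ x) y hy).trans (le_max_left _ _)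
    exact NNReal.coe_le_coe.2 (ENNReal.toNNReal_mono hfin hle)
  rcases eq_or_ne v 0 with rfl | hv
  · simp
  · have hnorm : ‖v‖ ≠ 0 := norm_ne_zero_iff.2 hv
    have hscaled := hunit (‖v‖⁻¹ • v) (by rw [norm_smul]; simp [hnorm])
    rwa [map_smul, norm_smul, norm_inv, norm_norm, inv_mul_le_iff₀ (by positivity), mul_comm]
      at hscaled

variable (nabla) in
/-- On the closed ball of radius `r` in the chart at `z`, the local representatives of locally
Lipschitz vector fields `ξ` are bounded by `C * p_K^lip(ξ)` and `C * p_K^lip(ξ)`-Lipschitz, where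
`K` is the corresponding chart ball in `M`. -/
structure IsAdaptedRadius (z : M) (C : ℝ≥0) (r : ℝ) : Prop where
  subset_target :
    Metric.closedBall (extChartAt 𝓘(ℝ, E) z z) r ⊆ (extChartAt 𝓘(ℝ, E) z).target
  norm_chartRep_le : ∀ ξ : (x : M) → TangentSpace 𝓘(ℝ, E) x,
    pLip nabla (chartBall (E := E) z r) ξ ≠ ⊤ → ∀ u ∈ Metric.closedBall (extChartAt 𝓘(ℝ, E) z z) r,
      ‖chartRep z ξ u‖ ≤ C * (pLip nabla (chartBall (E := E) z r) ξ).toNNReal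
  lipschitzOnWith_chartRep : ∀ ξ : (x : M) → TangentSpace 𝓘(ℝ, E) x, IsLipSection ξ →
    pLip nabla (chartBall (E := E) z r) ξ ≠ ⊤ →
      LipschitzOnWith (C * (pLip nabla (chartBall (E := E) z r) ξ).toNNReal) (chartRep z ξ)
        (Metric.closedBall (extChartAt 𝓘(ℝ, E) z z) r)

variable [IsContinuousRiemannianBundle E (fun x : M => TangentSpace 𝓘(ℝ, E) x)]

theorem exists_norm_chartDeriv_le (z : M) : ∃ C : ℝ≥0, ∀ᶠ y in 𝓝 z,
    (∀ v : TangentSpace 𝓘(ℝ, E) y, ‖chartDeriv z y v‖ ≤ C * ‖v‖) ∧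
    ∀ w : E, ‖chartDerivSymm z y w‖ ≤ C * ‖w‖ := by
  obtain ⟨C, -, hC⟩ :=
    eventually_norm_trivializationAt_lt E (fun x : M => TangentSpace 𝓘(ℝ, E) x) z
  obtain ⟨D, -, hD⟩ :=
    eventually_norm_symmL_trivializationAt_lt E (fun x : M => TangentSpace 𝓘(ℝ, E) x) z
  refine ⟨(max C D).toNNReal, ?_⟩
  filter_upwards [hC, hD] with y hCy hDy
  exact ⟨ContinuousLinearMap.le_of_opNorm_le _
      (hCy.le.trans ((le_max_left _ _).trans (Real.le_coe_toNNReal _))),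
    ContinuousLinearMap.le_of_opNorm_le _
      (hDy.le.trans ((le_max_right _ _).trans (Real.le_coe_toNNReal _)))⟩

variable [FiniteDimensional ℝ E] [T2Space M]

theorem exists_norm_localRep_le_pLip (hnabla : nabla.ContMDiffCovariantDerivative ∞) (z : M) :
    ∃ C : ℝ≥0, ∀ᶠ y in 𝓝 z, ∀ (ξ : (x : M) → TangentSpace 𝓘(ℝ, E) x) (K : Set M), y ∈ K →
      pLip nabla K ξ ≠ ⊤ → ‖localRep z ξ y‖ ≤ C * (pLip nabla K ξ).toNNReal ∧
        (MDiffAt (localRep z ξ) y → ‖mvfderiv 𝓘(ℝ, E) (localRep z ξ) y ∘L chartDerivSymm z y‖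
          ≤ C * (pLip nabla K ξ).toNNReal) := by
  obtain ⟨C, hC⟩ := exists_norm_chartDeriv_le (E := E) z
  obtain ⟨Γ, hΓ⟩ := exists_norm_christoffel_le hnabla z
  refine ⟨C + C * C + Γ * C, ?_⟩
  filter_upwards [hC, hΓ, chart_source_mem_nhds E z] with y hCy hΓy hy ξ K hyK hfin
  set L := (pLip nabla K ξ).toNNReal
  have hrep : ‖localRep z ξ y‖ ≤ C * L :=
    (hCy.1 _).trans (mul_le_mul_of_nonneg_left (norm_le_pLip hfin hyK) C.2)
  refine ⟨hrep.trans ?_, fun hξ => ?_⟩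
  · gcongr
    exact_mod_cast le_add_right (le_self_add)
  have hξ' := (mdifferentiableAt_localRep_iff hy).1 hξ
  have hnablaRep : ‖nablaRep nabla z ξ y‖ ≤ C * C * L := by
    refine ContinuousLinearMap.opNorm_le_bound _ (by positivity) fun w => ?_
    calc ‖chartDeriv z y (nabla ξ y (chartDerivSymm z y w))‖
        ≤ C * (L * (C * ‖w‖)) := (hCy.1 _).trans <| by
          gcongr
          exact (norm_nabla_apply_le_pLip hfin hyK hξ' _).trans (by gcongr; exact hCy.2 w)
      _ = C * C * L * ‖w‖ := by ring
  rw [← sub_eq_of_eq_add (nablaRep_eq_add_christoffel hy hξ')]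
  calc _ ≤ ‖nablaRep nabla z ξ y‖ + ‖christoffel nabla z y (localRep z ξ y)‖ := norm_sub_le _ _
    _ ≤ C * C * L + Γ * (C * L) :=
        add_le_add hnablaRep (ContinuousLinearMap.le_of_opNorm_le_of_le _ hΓy hrep)
    _ ≤ ↑(C + C * C + Γ * C) * L := by push_cast; nlinarith [C.2, L.2, mul_nonneg C.2 L.2]

theorem exists_eventually_isAdaptedRadius (hnabla : nabla.ContMDiffCovariantDerivative ∞) (z : M) :
    ∃ C : ℝ≥0, ∀ᶠ r in 𝓝[>] (0 : ℝ), IsAdaptedRadius nabla z C r := by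
  obtain ⟨C, hC⟩ := exists_norm_localRep_le_pLip hnabla z
  refine ⟨C, ?_⟩
  filter_upwards [eventually_closedBall_extChartAt (E := E) hC] with r hr
  have hmem : ∀ u ∈ Metric.closedBall (extChartAt 𝓘(ℝ, E) z z) r,
      (extChartAt 𝓘(ℝ, E) z).symm u ∈ chartBall (E := E) z r := fun u hu => mem_image_of_mem _ hu
  refine ⟨fun u hu => (hr u hu).1, fun ξ hfin u hu => ((hr u hu).2 ξ _ (hmem u hu) hfin).1,
    fun ξ hξ hfin => ?_⟩
  obtain ⟨K, hK⟩ := LocallyLipschitzOn.exists_lipschitzOnWith_of_compact (isCompact_closedBall _ _)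
    ((hξ.locallyLipschitzOn_chartRep z).mono fun u hu => (hr u hu).1)
  refine lipschitzOnWith_closedBall_of_norm_fderiv_le hK fun u hu hd => ?_
  obtain ⟨hut, hest⟩ := hr u (Metric.ball_subset_closedBall hu)
  have hmd := mdifferentiableAt_localRep_of_chartRep hut hd
  rw [fderiv_chartRep hut hmd]
  exact (hest ξ _ (hmem u (Metric.ball_subset_closedBall hu)) hfin).2 hmd

end ChartEstimate

/-! ### The Riemannian distance in charts -/

theorem enorm_le_mul_enorm {E F : Type*} [SeminormedAddGroup E] [SeminormedAddGroup F] {C : ℝ≥0}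
    {x : E} {y : F} (h : ‖x‖ ≤ C * ‖y‖) : ‖x‖ₑ ≤ C * ‖y‖ₑ := by
  simpa only [enorm, ← ENNReal.coe_mul, ENNReal.coe_le_coe, ← NNReal.coe_le_coe] using! h

section ChartCurves

variable {E : Type*} [NormedAddCommGroup E] [NormedSpace ℝ E]
  {M : Type*} [TopologicalSpace M] [ChartedSpace E M] [IsManifold 𝓘(ℝ, E) ∞ M]
  {z : M} {s : Set ℝ} {t : ℝ}

theorem hasDerivWithinAt_extChartAt_comp {γ : ℝ → M} {v : TangentSpace 𝓘(ℝ, E) (γ t)}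
    (hγ : HasMFDerivWithinAt 𝓘(ℝ, ℝ) 𝓘(ℝ, E) γ s t ((1 : ℝ →L[ℝ] ℝ).smulRight v))
    (hz : γ t ∈ (chartAt E z).source) :
    HasDerivWithinAt (fun t => extChartAt 𝓘(ℝ, E) z (γ t)) (chartDeriv z (γ t) v) s t := by
  have hφ := (mdifferentiableAt_extChartAt (I := 𝓘(ℝ, E)) hz).hasMFDerivAt
  rw [chartDeriv_eq_mfderiv (E := E) hz]
  let A : ℝ →L[ℝ] E := mfderiv% (extChartAt 𝓘(ℝ, E) z) (γ t) ∘L (1 : ℝ →L[ℝ] ℝ).smulRight v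
  have hφγ : HasFDerivWithinAt (fun t => extChartAt 𝓘(ℝ, E) z (γ t)) A s t :=
    (hφ.comp_hasMFDerivWithinAt t hγ).hasFDerivWithinAt
  exact hφγ.hasDerivWithinAt.congr_deriv
    (congrArg (mfderiv% (extChartAt 𝓘(ℝ, E) z) (γ t)) (one_smul ℝ v))

theorem hasMFDerivWithinAt_extChartAt_symm_comp {c : ℝ → E} {w : E} (hc : HasDerivWithinAt c w s t)
    (hz : c t ∈ (extChartAt 𝓘(ℝ, E) z).target) :
    HasMFDerivWithinAt 𝓘(ℝ, ℝ) 𝓘(ℝ, E) (fun t => (extChartAt 𝓘(ℝ, E) z).symm (c t)) s t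
      ((1 : ℝ →L[ℝ] ℝ).smulRight (chartDerivSymm z ((extChartAt 𝓘(ℝ, E) z).symm (c t)) w)) := by
  have hsymm := (contMDiffAt_extChartAt_symm hz).mdifferentiableAt (by simp)
  have hderiv := chartDerivSymm_eq_mfderiv (extChartAt_symm_mem_chart_source hz)
  rw [(extChartAt 𝓘(ℝ, E) z).right_inv hz] at hderiv
  rw [hderiv]
  refine (hsymm.hasMFDerivAt.comp_hasMFDerivWithinAt t
    hc.hasFDerivWithinAt.hasMFDerivWithinAt).congr_mfderiv (ContinuousLinearMap.ext_ring ?_)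
  change mfderiv% (extChartAt 𝓘(ℝ, E) z).symm (c t) ((1 : ℝ) • w) =
    (1 : ℝ) • mfderiv% (extChartAt 𝓘(ℝ, E) z).symm (c t) w
  exact map_smul _ _ _

variable [RiemannianBundle (fun x : M => TangentSpace 𝓘(ℝ, E) x)] {C : ℝ≥0}

theorem edist_extChartAt_le_pathELength {γ : ℝ → M} {a b : ℝ} (hab : a < b)
    (hγ : ContMDiffOn 𝓘(ℝ, ℝ) 𝓘(ℝ, E) 1 γ (Icc a b))
    (hz : ∀ t ∈ Icc a b, γ t ∈ (chartAt E z).source)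
    (hC : ∀ t ∈ Icc a b, ∀ v : TangentSpace 𝓘(ℝ, E) (γ t), ‖chartDeriv z (γ t) v‖ ≤ C * ‖v‖) :
    edist (extChartAt 𝓘(ℝ, E) z (γ a)) (extChartAt 𝓘(ℝ, E) z (γ b))
      ≤ C * Manifold.pathELength 𝓘(ℝ, E) γ a b := by
  have hφγ : ContDiffOn ℝ 1 (fun s => extChartAt 𝓘(ℝ, E) z (γ s)) (Icc a b) := by
    rw [← contMDiffOn_iff_contDiffOn]
    exact contMDiffOn_extChartAt.comp (t := (chartAt E z).source) hγ hz
  rw [edist_comm, edist_eq_enorm_sub, Manifold.pathELength_eq_lintegral_mfderivWithin_Icc,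
    ← lintegral_const_mul' _ _ ENNReal.coe_ne_top]
  refine (enorm_sub_le_lintegral_derivWithin_Icc_of_contDiffOn_Icc hφγ hab.le).trans
    (setLIntegral_mono' measurableSet_Icc fun t ht => ?_)
  have hderiv := (hγ.mdifferentiableOn one_ne_zero t ht).hasMFDerivWithinAt
  set A := mfderivWithin 𝓘(ℝ, ℝ) 𝓘(ℝ, E) γ (Icc a b) t
  rw [show A = (1 : ℝ →L[ℝ] ℝ).smulRight (A 1) from
    ContinuousLinearMap.ext_ring (one_smul ℝ (A 1)).symm] at hderiv
  rw [(hasDerivWithinAt_extChartAt_comp hderiv (hz t ht)).derivWithin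
    (uniqueDiffOn_Icc hab t ht)]
  exact enorm_le_mul_enorm (hC t ht (A 1))

theorem riemannianEDist_extChartAt_symm_le {B : Set E} (hB : Convex ℝ B)
    (hBt : B ⊆ (extChartAt 𝓘(ℝ, E) z).target)
    (hC : ∀ u ∈ B, ∀ w : E,
      ‖chartDerivSymm z ((extChartAt 𝓘(ℝ, E) z).symm u) w‖ ≤ C * ‖w‖)
    {u v : E} (hu : u ∈ B) (hv : v ∈ B) :
    Manifold.riemannianEDist 𝓘(ℝ, E)
      ((extChartAt 𝓘(ℝ, E) z).symm u) ((extChartAt 𝓘(ℝ, E) z).symm v) ≤ C * edist u v := by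
  have hc : ∀ t ∈ Icc (0 : ℝ) 1, AffineMap.lineMap u v t ∈ B := fun _ ht =>
    hB.lineMap_mem hu hv ht
  have hsmooth : ContMDiffOn 𝓘(ℝ, ℝ) 𝓘(ℝ, E) 1
      (fun t : ℝ => (extChartAt 𝓘(ℝ, E) z).symm (AffineMap.lineMap u v t)) (Icc 0 1) :=
    (contMDiffOn_extChartAt_symm z).comp
      (contMDiffOn_iff_contDiffOn.2 (AffineMap.contDiff_lineMap u v).contDiffOn)
      (fun _ ht => hBt (hc _ ht))
  refine (Manifold.riemannianEDist_le_pathELength hsmooth (by simp) (by simp) zero_le_one).trans ?_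
  rw [Manifold.pathELength_eq_lintegral_mfderivWithin_Icc]
  calc _ ≤ ∫⁻ _ in Icc (0 : ℝ) 1, (C : ℝ≥0∞) * edist u v :=
        setLIntegral_mono' measurableSet_Icc fun t ht => ?_
    _ = C * edist u v := by simp
  rw [(hasMFDerivWithinAt_extChartAt_symm_comp AffineMap.hasDerivWithinAt_lineMap
    (hBt (hc t ht))).mfderivWithin
      (uniqueMDiffWithinAt_iff_uniqueDiffWithinAt.2 (uniqueDiffOn_Icc zero_lt_one t ht)),
    edist_comm, edist_eq_enorm_sub]
  exact (congrArg enorm (one_smul ℝ _)).trans_le (enorm_le_mul_enorm (hC _ (hc t ht) (v - u)))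

end ChartCurves

section Distance

variable {E : Type*} [NormedAddCommGroup E] [NormedSpace ℝ E]
  {M : Type*} [PseudoEMetricSpace M] [ChartedSpace E M] [IsManifold 𝓘(ℝ, E) ∞ M]
  [RiemannianBundle (fun x : M => TangentSpace 𝓘(ℝ, E) x)]
  [IsContinuousRiemannianBundle E (fun x : M => TangentSpace 𝓘(ℝ, E) x)]
  [IsRiemannianManifold 𝓘(ℝ, E) M]

theorem exists_lipschitzOnWith_extChartAt (z : M) :
    ∃ C : ℝ≥0, ∃ V ∈ 𝓝 z, LipschitzOnWith C (extChartAt 𝓘(ℝ, E) z) V := by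
  obtain ⟨C, hC⟩ := exists_norm_chartDeriv_le (E := E) z
  obtain ⟨ε, hε, hball⟩ := EMetric.mem_nhds_iff.1 (hC.and (chart_source_mem_nhds E z))
  refine ⟨C, _, Metric.eball_mem_nhds z (ENNReal.half_pos (ENNReal.half_pos hε.ne').ne'),
    fun x hx y hy => ?_⟩
  have hxy : edist x y < ε / 2 := (edist_triangle_right x y z).trans_lt
    ((ENNReal.add_lt_add hx hy).trans_eq (ENNReal.add_halves _))
  have hlim : Tendsto (fun l : ℝ≥0∞ => C * l) (𝓝[>] edist x y) (𝓝 (C * edist x y)) :=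
    (ENNReal.continuous_const_mul ENNReal.coe_ne_top).continuousWithinAt
  have := nhdsGT_neBot_of_exists_gt ⟨_, hxy⟩
  refine ge_of_tendsto hlim ?_
  filter_upwards [Ioo_mem_nhdsGT hxy] with l hl
  rw [IsRiemannianManifold.out (I := 𝓘(ℝ, E)) x y] at hl
  obtain ⟨γ, hγx, hγy, hγ, hlen⟩ := Manifold.exists_lt_of_riemannianEDist_lt hl.1
  -- Paths shorter than `ε / 2` issued from `x` stay in the ball of radius `ε`.
  have hγε : ∀ t ∈ Icc (0 : ℝ) 1, γ t ∈ Metric.eball z ε := by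
    intro t ht
    have hdist : edist x (γ t) < ε / 2 := by
      rw [IsRiemannianManifold.out (I := 𝓘(ℝ, E)) x (γ t)]
      exact (Manifold.riemannianEDist_le_pathELength (hγ.mono (Icc_subset_Icc_right ht.2)) hγx rfl
        ht.1).trans_lt ((Manifold.pathELength_mono le_rfl ht.2).trans_lt (hlen.trans hl.2))
    calc edist (γ t) z ≤ edist x (γ t) + edist x z := edist_triangle_left _ _ _
      _ < ε / 2 + ε / 2 := ENNReal.add_lt_add hdist (hx.trans_le ENNReal.half_le_self)
      _ = ε := ENNReal.add_halves ε
  calc edist (extChartAt 𝓘(ℝ, E) z x) (extChartAt 𝓘(ℝ, E) z y)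
      ≤ C * Manifold.pathELength 𝓘(ℝ, E) γ 0 1 := hγx ▸ hγy ▸ edist_extChartAt_le_pathELength
        zero_lt_one hγ (fun t ht => (hball (hγε t ht)).2) fun t ht => (hball (hγε t ht)).1.1
    _ ≤ C * l := by gcongr

theorem exists_eventually_lipschitzOnWith_extChartAt_symm (z : M) :
    ∃ C : ℝ≥0, ∀ᶠ r in 𝓝[>] (0 : ℝ), LipschitzOnWith C (extChartAt 𝓘(ℝ, E) z).symm
      (Metric.closedBall (extChartAt 𝓘(ℝ, E) z z) r) := by
  obtain ⟨C, hC⟩ := exists_norm_chartDeriv_le (E := E) z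
  refine ⟨C, ?_⟩
  filter_upwards [eventually_closedBall_extChartAt (E := E) hC] with r hr u hu v hv
  rw [IsRiemannianManifold.out (I := 𝓘(ℝ, E))]
  exact riemannianEDist_extChartAt_symm_le (convex_closedBall _ _) (fun w hw => (hr w hw).1)
    (fun w hw => (hr w hw).2.2) hu hv

theorem exists_eventually_lipschitzOnWith_extChartAt_chartBall (z : M) :
    ∃ C : ℝ≥0, ∀ᶠ r in 𝓝[>] (0 : ℝ),
      LipschitzOnWith C (extChartAt 𝓘(ℝ, E) z) (chartBall (E := E) z r) := by
  obtain ⟨C, V, hV, hC⟩ := exists_lipschitzOnWith_extChartAt (E := E) z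
  refine ⟨C, ?_⟩
  filter_upwards [eventually_closedBall_extChartAt (E := E) hV] with r hr
  exact hC.mono (image_subset_iff.2 fun u hu => (hr u hu).2)

end Distance

/-! ### Integral curves -/

section AbsolutelyContinuous

variable {h k : ℝ → ℝ} {a b c : ℝ}

theorem absolutelyContinuousOnInterval_congr (hh : AbsolutelyContinuousOnInterval h a b)
    (hk : EqOn k h (uIcc a b)) : AbsolutelyContinuousOnInterval k a b :=
  absolutelyContinuousOnInterval_of_dist_le (C := 1) hh fun s hs t ht => by
    rw [hk hs, hk ht, NNReal.coe_one, one_mul]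

theorem absolutelyContinuousOnInterval_trans (hab : AbsolutelyContinuousOnInterval h a b)
    (hbc : AbsolutelyContinuousOnInterval h b c) : AbsolutelyContinuousOnInterval h a c := by
  have hint : IntervalIntegrable (deriv h) volume a c :=
    hab.intervalIntegrable_deriv.trans hbc.intervalIntegrable_deriv
  have hprim : ∀ t ∈ uIcc a c, h t = h a + ∫ s in a..t, deriv h s := by
    intro t ht
    rcases uIcc_subset_uIcc_union_uIcc (b := b) ht with ht | ht
    · rw [(hab.mono (uIcc_subset_uIcc_left ht)).integral_deriv_eq_sub, add_sub_cancel]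
    · have hbt := hbc.mono (uIcc_subset_uIcc_left ht)
      rw [← intervalIntegral.integral_add_adjacent_intervals hab.intervalIntegrable_deriv
        hbt.intervalIntegrable_deriv, hab.integral_deriv_eq_sub, hbt.integral_deriv_eq_sub]
      ring
  refine absolutelyContinuousOnInterval_of_dist_le (C := 1)
    (hint.absolutelyContinuousOnInterval_intervalIntegral left_mem_uIcc) fun s hs t ht => ?_
  rw [hprim s hs, hprim t ht, dist_add_left, NNReal.coe_one, one_mul]

theorem ae_mem_nhds_of_ordConnected {J : Set ℝ} (hJ : J.OrdConnected) :
    ∀ᵐ t : ℝ, t ∈ J → J ∈ 𝓝 t := by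
  filter_upwards [measure_eq_zero_iff_ae_notMem.1 (hJ.convex.addHaar_frontier volume)] with t ht htJ
  rw [← mem_interior_iff_mem_nhds]
  by_contra h
  exact ht ⟨subset_closure htJ, h⟩

end AbsolutelyContinuous

section Curves

variable {E : Type*} [NormedAddCommGroup E] [NormedSpace ℝ E]
  {M : Type*} [TopologicalSpace M] [ChartedSpace E M]
  {T : Set ℝ} {X : ℝ → (x : M) → TangentSpace 𝓘(ℝ, E) x} {γ γ' : ℝ → M} {J J' : Set ℝ}
  {a b τ : ℝ} {x y z : M}

theorem LocACOn.continuousOn [FiniteDimensional ℝ E] [T2Space M] [IsManifold 𝓘(ℝ, E) ∞ M]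
    (h : LocACOn (E := E) γ J) (ha : a ∈ J) (hb : b ∈ J) : ContinuousOn γ (uIcc a b) := by
  intro t ht
  refine (SmoothBumpFunction.nhds_basis_support (I := 𝓘(ℝ, E)) univ_mem).tendsto_right_iff.2
    fun f _ => ?_
  have hne : (f ∘ γ) t ≠ 0 := by simp
  exact ((h f f.contMDiff a ha b hb).continuousOn t ht).eventually_ne hne

theorem IsIntCurve.mono (h : IsIntCurve T X γ J) (hJ : J' ⊆ J) (ho : J'.OrdConnected) :
    IsIntCurve T X γ J' where
  ordConnected := ho
  subset := hJ.trans h.subset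
  locAC f hf a ha b hb := h.locAC f hf a (hJ ha) b (hJ hb)
  deriv := h.deriv.mono fun _ ht htJ => (ht (hJ htJ)).mono hJ

theorem IsIntCurve.congr (h : IsIntCurve T X γ J) (he : EqOn γ' γ J) : IsIntCurve T X γ' J where
  ordConnected := h.ordConnected
  subset := h.subset
  locAC f hf a ha b hb := absolutelyContinuousOnInterval_congr (h.locAC f hf a ha b hb)
    fun _ ht => congrArg f (he (h.ordConnected.uIcc_subset ha hb ht))
  deriv := by
    filter_upwards [h.deriv] with t ht htJ
    rw [he htJ]
    exact (ht htJ).congr_mono (fun _ hs => he hs) (he htJ) Subset.rfl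

theorem IsIntCurve.union (h : IsIntCurve T X γ J) (h' : IsIntCurve T X γ J') (hb : b ∈ J)
    (hb' : b ∈ J') : IsIntCurve T X γ (J ∪ J') where
  ordConnected :=
    (h.ordConnected.isPreconnected.union b hb hb' h'.ordConnected.isPreconnected).ordConnected
  subset := union_subset h.subset h'.subset
  locAC f hf := by
    have hac : ∀ s ∈ J ∪ J', AbsolutelyContinuousOnInterval (f ∘ γ) s b :=
      fun s hs => hs.elim (fun hs => h.locAC f hf s hs b hb) fun hs => h'.locAC f hf s hs b hb'
    exact fun s hs t ht => absolutelyContinuousOnInterval_trans (hac s hs) (hac t ht).symm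
  deriv := by
    filter_upwards [h.deriv, h'.deriv, ae_mem_nhds_of_ordConnected h.ordConnected,
      ae_mem_nhds_of_ordConnected h'.ordConnected] with t ht ht' hn hn' htJ
    rcases htJ with htJ | htJ
    · exact ((ht htJ).hasMFDerivAt (hn htJ)).hasMFDerivWithinAt
    · exact ((ht' htJ).hasMFDerivAt (hn' htJ)).hasMFDerivWithinAt

theorem IsIntCurve.reaches (h : IsIntCurve T X γ J) (ha : a ∈ J) (hb : b ∈ J) :
    Reaches T X b a (γ a) (γ b) :=
  ⟨J, γ, h, ha, rfl, hb, rfl⟩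

theorem Reaches.exists_isIntCurve_uIcc (h : Reaches T X τ a x y) :
    ∃ γ : ℝ → M, IsIntCurve T X γ (uIcc a τ) ∧ γ a = x ∧ γ τ = y := by
  obtain ⟨J, γ, hγ, ha, hx, hτ, hy⟩ := h
  exact ⟨γ, hγ.mono (hγ.ordConnected.uIcc_subset ha hτ) ordConnected_uIcc, hx, hy⟩

theorem Reaches.exists_between (h : Reaches T X τ a x y) (hb : b ∈ uIcc a τ) :
    ∃ z, Reaches T X b a x z ∧ Reaches T X τ b z y := by
  obtain ⟨γ, hγ, rfl, rfl⟩ := h.exists_isIntCurve_uIcc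
  exact ⟨γ b, hγ.reaches left_mem_uIcc hb, hγ.reaches hb right_mem_uIcc⟩

theorem Reaches.trans (hxz : Reaches T X b a x z) (hzy : Reaches T X τ b z y)
    (hb : b ∈ uIcc a τ) : Reaches T X τ a x y := by
  classical
  obtain ⟨γ₁, hγ₁, rfl, rfl⟩ := hxz.exists_isIntCurve_uIcc
  obtain ⟨γ₂, hγ₂, heq, rfl⟩ := hzy.exists_isIntCurve_uIcc
  let γ : ℝ → M := (uIcc a b).piecewise γ₁ γ₂
  have h₁ : EqOn γ γ₁ (uIcc a b) := piecewise_eqOn _ _ _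
  have h₂ : EqOn γ γ₂ (uIcc b τ) := by
    intro t ht
    by_cases hta : t ∈ uIcc a b
    · obtain rfl : t = b := by grind [mem_uIcc]
      rw [h₁ hta, heq]
    · exact piecewise_eq_of_notMem _ _ _ hta
  rw [← h₁ left_mem_uIcc, ← h₂ right_mem_uIcc]
  exact ((hγ₁.congr h₁).union (hγ₂.congr h₂) right_mem_uIcc left_mem_uIcc).reaches
    (mem_union_left _ left_mem_uIcc) (mem_union_right _ right_mem_uIcc)

theorem reaches_eq_comp (hb : b ∈ uIcc a τ) :
    Reaches T X τ a = Relation.Comp (Reaches T X b a) (Reaches T X τ b) := by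
  ext x y
  exact ⟨fun h => h.exists_between hb, fun ⟨_, hxz, hzy⟩ => hxz.trans hzy hb⟩

end Curves

/-! ### Integral curves in a chart -/

theorem eqOn_of_isPreconnected {Y Z : Type*} [TopologicalSpace Y] [TopologicalSpace Z] [T2Space Z]
    {f g : Y → Z} {S : Set Y} (hS : IsPreconnected S) (hf : ContinuousOn f S)
    (hg : ContinuousOn g S) (hloc : ∀ t ∈ S, f t = g t → ∀ᶠ s in 𝓝[S] t, f s = g s) {a : Y}
    (ha : a ∈ S) (hfg : f a = g a) : EqOn f g S := by
  have : PreconnectedSpace S := isPreconnected_iff_preconnectedSpace.1 hS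
  have hclopen : IsClopen {t : S | f t = g t} :=
    ⟨isClosed_eq hf.domRestrict hg.domRestrict, isOpen_iff_mem_nhds.2 fun t ht =>
      (eventually_nhds_subtype_iff S t _).2 (hloc t t.2 ht)⟩
  exact fun t ht => (hclopen.eq_univ ⟨⟨a, ha⟩, hfg⟩ ▸ mem_univ (⟨t, ht⟩ : S) :)

section ChartFlow

variable {E : Type*} [NormedAddCommGroup E] [NormedSpace ℝ E] [FiniteDimensional ℝ E]
  {M : Type*} [TopologicalSpace M] [ChartedSpace E M] [IsManifold 𝓘(ℝ, E) ∞ M] [T2Space M]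
  {T : Set ℝ} {X : ℝ → (x : M) → TangentSpace 𝓘(ℝ, E) x} {z : M} {m : ℝ → ℝ≥0} {r a b : ℝ}
  {γ : ℝ → M} {u : ℝ → E}

omit [FiniteDimensional ℝ E] [IsManifold 𝓘(ℝ, E) ∞ M] [T2Space M] in
theorem mem_chartBall_iff
    (hr : Metric.closedBall (extChartAt 𝓘(ℝ, E) z z) r ⊆ (extChartAt 𝓘(ℝ, E) z).target) {y : M} :
    y ∈ chartBall (E := E) z r ↔ y ∈ (chartAt E z).source ∧
      extChartAt 𝓘(ℝ, E) z y ∈ Metric.closedBall (extChartAt 𝓘(ℝ, E) z z) r := by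
  rw [chartBall, (extChartAt 𝓘(ℝ, E) z).symm_image_eq_source_inter_preimage hr,
    extChartAt_source, mem_inter_iff, mem_preimage]

theorem LocACOn.comp_extChartAt {l : StrongDual ℝ E} (h : LocACOn (E := E) γ (uIcc a b))
    (hr : 0 < r)
    (hsub : Metric.closedBall (extChartAt 𝓘(ℝ, E) z z) r ⊆ (extChartAt 𝓘(ℝ, E) z).target)
    (hγ : MapsTo γ (uIcc a b) (chartBall (E := E) z r)) :
    AbsolutelyContinuousOnInterval (fun t => l (extChartAt 𝓘(ℝ, E) z (γ t))) a b := by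
  obtain ⟨δ, hδ, hball⟩ := (isCompact_closedBall (extChartAt 𝓘(ℝ, E) z z) r)
    |>.exists_cthickening_subset_open (isOpen_extChartAt_target z) hsub
  rw [cthickening_closedBall hδ.le hr.le] at hball
  let f : SmoothBumpFunction 𝓘(ℝ, E) z :=
    ⟨⟨r, δ + r, hr, lt_add_of_pos_left r hδ⟩, fun e he => hball he.1⟩
  have hf : ContMDiff 𝓘(ℝ, E) 𝓘(ℝ, ℝ) ∞ fun x => f x • l (extChartAt 𝓘(ℝ, E) z x) :=
    f.contMDiff_smul (l.contDiff.contMDiff.comp_contMDiffOn contMDiffOn_extChartAt)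
  refine absolutelyContinuousOnInterval_congr (h _ hf a left_mem_uIcc b right_mem_uIcc)
    fun t ht => ?_
  obtain ⟨hsource, hmem⟩ := (mem_chartBall_iff hsub).1 (hγ ht)
  have hone : f (γ t) = 1 := f.one_of_dist_le hsource hmem
  simp [hone]

theorem IsIntCurve.isIntegralSolution (h : IsIntCurve T X γ (uIcc a b)) (hr : 0 < r)
    (hsub : Metric.closedBall (extChartAt 𝓘(ℝ, E) z z) r ⊆ (extChartAt 𝓘(ℝ, E) z).target)
    (hcar : IsCaratheodoryOn (fun t => chartRep z (X t)) m
      (Metric.closedBall (extChartAt 𝓘(ℝ, E) z z) r) (uIcc a b))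
    (hγ : MapsTo γ (uIcc a b) (chartBall (E := E) z r)) :
    IsIntegralSolution (fun t => chartRep z (X t))
      (Metric.closedBall (extChartAt 𝓘(ℝ, E) z z) r) a b fun t => extChartAt 𝓘(ℝ, E) z (γ t) := by
  have hmem := fun t (ht : t ∈ uIcc a b) => (mem_chartBall_iff hsub).1 (hγ ht)
  have hcont : ContinuousOn (fun t => extChartAt 𝓘(ℝ, E) z (γ t)) (uIcc a b) :=
    (continuousOn_extChartAt z).comp (h.locAC.continuousOn left_mem_uIcc right_mem_uIcc)
      fun t ht => by rw [extChartAt_source]; exact (hmem t ht).1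
  have hmaps : MapsTo (fun t => extChartAt 𝓘(ℝ, E) z (γ t)) (uIcc a b)
      (Metric.closedBall (extChartAt 𝓘(ℝ, E) z z) r) := fun t ht => (hmem t ht).2
  refine ⟨hcont, hmaps, fun t ht => ?_⟩
  have hsubset : uIcc a t ⊆ uIcc a b := uIcc_subset_uIcc_left ht
  have hcurve := h.mono hsubset ordConnected_uIcc
  rw [integral_eq_sub_of_forall_dual (h := fun s => extChartAt 𝓘(ℝ, E) z (γ s))
    (fun l => hcurve.locAC.comp_extChartAt hr hsub (hγ.mono_left hsubset)) ?_
    (intervalIntegrable_of_integrableOn_uIcc (hcar.integrableOn_comp hcont hmaps) left_mem_uIcc ht),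
    add_sub_cancel]
  filter_upwards [hcurve.deriv, ae_mem_nhds_of_ordConnected ordConnected_uIcc] with s hs hn hsm
  have hsm' := uIoc_subset_uIcc hsm
  obtain ⟨hsource, -⟩ := hmem s (hsubset hsm')
  refine ((hasDerivWithinAt_extChartAt_comp (hs hsm') hsource).hasDerivAt (hn hsm')).congr_deriv ?_
  rw [chartRep, localRep, (extChartAt 𝓘(ℝ, E) z).left_inv (by rwa [extChartAt_source])]

omit [T2Space M] in
theorem IsIntegralSolution.isIntCurve
    (hu : IsIntegralSolution (fun t => chartRep z (X t))
      (Metric.closedBall (extChartAt 𝓘(ℝ, E) z z) r) a b u) (hT : uIcc a b ⊆ T)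
    (hsub : Metric.closedBall (extChartAt 𝓘(ℝ, E) z z) r ⊆ (extChartAt 𝓘(ℝ, E) z).target)
    (hcar : IsCaratheodoryOn (fun t => chartRep z (X t)) m
      (Metric.closedBall (extChartAt 𝓘(ℝ, E) z z) r) (uIcc a b)) :
    IsIntCurve T X (fun t => (extChartAt 𝓘(ℝ, E) z).symm (u t)) (uIcc a b) := by
  have hint := intervalIntegrable_of_integrableOn_uIcc
    (hcar.integrableOn_comp hu.continuousOn hu.mapsTo) left_mem_uIcc right_mem_uIcc
  refine ⟨ordConnected_uIcc, hT, fun f hf s hs t ht => ?_, ?_⟩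
  · obtain ⟨K, hK⟩ : ∃ K : ℝ≥0, LipschitzOnWith K (f ∘ (extChartAt 𝓘(ℝ, E) z).symm)
        (Metric.closedBall (extChartAt 𝓘(ℝ, E) z z) r) := by
      refine LocallyLipschitzOn.exists_lipschitzOnWith_of_compact (isCompact_closedBall _ _)
        fun e he => ?_
      obtain ⟨K, U, hU, h⟩ := ((hf.contMDiffAt.comp e (contMDiffAt_extChartAt_symm (hsub he)))
        |>.contDiffAt.of_le (m := 1) (by simp)).exists_lipschitzOnWith
      exact ⟨K, U, mem_nhdsWithin_of_mem_nhds hU, h⟩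
    have hac := absolutelyContinuousOnInterval_of_dist_le (hu.absolutelyContinuousOnInterval hcar)
      fun s hs t ht => hK.dist_le_mul _ (hu.mapsTo hs) _ (hu.mapsTo ht)
    exact hac.mono (uIcc_subset_uIcc hs ht)
  · filter_upwards [hint.ae_hasDerivAt_integral] with t hderiv ht
    have hut : HasDerivWithinAt u (chartRep z (X t) (u t)) (uIcc a b) t :=
      ((hderiv ht a left_mem_uIcc).const_add (u a)).hasDerivWithinAt.congr hu.eq_integral
        (hu.eq_integral t ht)
    have htarget := hsub (hu.mapsTo ht)
    have hcurve := hasMFDerivWithinAt_extChartAt_symm_comp hut htarget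
    rwa [chartRep, localRep,
      chartDerivSymm_chartDeriv (extChartAt_symm_mem_chart_source htarget)] at hcurve

theorem IsIntCurve.eqOn_extChartAt_symm (h : IsIntCurve T X γ (uIcc a b)) (hr : 0 < r)
    (hsub : Metric.closedBall (extChartAt 𝓘(ℝ, E) z z) r ⊆ (extChartAt 𝓘(ℝ, E) z).target)
    (hcar : IsCaratheodoryOn (fun t => chartRep z (X t)) m
      (Metric.closedBall (extChartAt 𝓘(ℝ, E) z z) r) (uIcc a b))
    (hm : ∫ t in uIcc a b, (m t : ℝ) ≤ 1 / 2)
    (hu : IsIntegralSolution (fun t => chartRep z (X t))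
      (Metric.closedBall (extChartAt 𝓘(ℝ, E) z z) r) a b u)
    (hub : MapsTo u (uIcc a b) (Metric.ball (extChartAt 𝓘(ℝ, E) z z) r))
    (ha : γ a = (extChartAt 𝓘(ℝ, E) z).symm (u a)) :
    EqOn γ (fun t => (extChartAt 𝓘(ℝ, E) z).symm (u t)) (uIcc a b) := by
  have hγc : ContinuousOn γ (uIcc a b) := h.locAC.continuousOn left_mem_uIcc right_mem_uIcc
  have hηc : ContinuousOn (fun t => (extChartAt 𝓘(ℝ, E) z).symm (u t)) (uIcc a b) :=
    (continuousOn_extChartAt_symm z).comp hu.continuousOn fun t ht => hsub (hu.mapsTo ht)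
  let V : Set M := (chartAt E z).source ∩
    extChartAt 𝓘(ℝ, E) z ⁻¹' Metric.ball (extChartAt 𝓘(ℝ, E) z z) r
  have hVopen : IsOpen V := isOpen_extChartAt_preimage z Metric.isOpen_ball
  have hopen : ∀ t ∈ uIcc a b, γ t = (extChartAt 𝓘(ℝ, E) z).symm (u t) →
      ∀ᶠ s in 𝓝[uIcc a b] t, γ s = (extChartAt 𝓘(ℝ, E) z).symm (u s) := by
    intro t ht heq
    have htV : γ t ∈ V := by
      rw [heq]
      refine ⟨extChartAt_symm_mem_chart_source (hsub (hu.mapsTo ht)), ?_⟩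
      rw [mem_preimage, (extChartAt 𝓘(ℝ, E) z).right_inv (hsub (hu.mapsTo ht))]
      exact hub ht
    have hnear : ∀ᶠ s in 𝓝[uIcc a b] t, ∀ s' ∈ uIcc t s, γ s' ∈ V :=
      (((tendsto_const_pure.mono_right (pure_le_nhdsWithin ht)).uIcc tendsto_id).eventually
        (eventually_smallSets_forall.2 ((hγc t ht).eventually (hVopen.mem_nhds htV))))
    filter_upwards [hnear, self_mem_nhdsWithin] with s hs hsJ
    have hsubset : uIcc t s ⊆ uIcc a b := uIcc_subset_uIcc ht hsJ
    have hcar' := hcar.mono hsubset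
    have hsol := (h.mono hsubset ordConnected_uIcc).isIntegralSolution hr hsub hcar'
      fun t' ht' => (mem_chartBall_iff hsub).2
        ⟨(hs t' ht').1, Metric.ball_subset_closedBall (hs t' ht').2⟩
    have hφγ : extChartAt 𝓘(ℝ, E) z (γ s) = u s :=
      hsol.eqOn hcar' ((hcar.setIntegral_mono hsubset).trans hm) (hu.mono hcar ht hsJ)
        (by rw [heq, (extChartAt 𝓘(ℝ, E) z).right_inv (hsub (hu.mapsTo ht))]) right_mem_uIcc
    rw [← hφγ, (extChartAt 𝓘(ℝ, E) z).left_inv]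
    rw [extChartAt_source]
    exact (hs s right_mem_uIcc).1
  exact eqOn_of_isPreconnected isPreconnected_uIcc hγc hηc hopen left_mem_uIcc ha

/-- The conditions under which Picard iteration in the chart around `z` gives, from every initial
value in the ball of radius `r / 2`, a unique integral curve of `X` on `uIcc a b`, staying in the
ball of radius `r`. -/
structure IsPicardOn (X : ℝ → (x : M) → TangentSpace 𝓘(ℝ, E) x) (z : M) (r : ℝ) (m : ℝ → ℝ≥0)
    (a b : ℝ) : Prop where
  pos : 0 < r
  subset_target : Metric.closedBall (extChartAt 𝓘(ℝ, E) z z) r ⊆ (extChartAt 𝓘(ℝ, E) z).target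
  isCaratheodoryOn : IsCaratheodoryOn (fun t => chartRep z (X t)) m
    (Metric.closedBall (extChartAt 𝓘(ℝ, E) z z) r) (uIcc a b)
  integral_le_half : ∫ t in uIcc a b, (m t : ℝ) ≤ 1 / 2
  integral_le_radius : ∫ t in uIcc a b, (m t : ℝ) ≤ r / 4

theorem IsPicardOn.exists_isIntegralSolution_reaches_iff (h : IsPicardOn X z r m a b)
    (hT : uIcc a b ⊆ T) {x : M} (hx : x ∈ chartBall (E := E) z (r / 2)) :
    ∃ u : ℝ → E, IsIntegralSolution (fun t => chartRep z (X t))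
        (Metric.closedBall (extChartAt 𝓘(ℝ, E) z z) r) a b u ∧ u a = extChartAt 𝓘(ℝ, E) z x ∧
      ∀ τ ∈ uIcc a b, ∀ y, Reaches T X τ a x y ↔ y = (extChartAt 𝓘(ℝ, E) z).symm (u τ) := by
  obtain ⟨hr, hsub, hcar, hm, hmr⟩ := h
  obtain ⟨hxs, hxB⟩ := (mem_chartBall_iff
    ((Metric.closedBall_subset_closedBall (half_le_self hr.le)).trans hsub)).1 hx
  obtain ⟨u, hu, hua⟩ := hcar.exists_isIntegralSolution Metric.isClosed_closedBall hm
    (x := extChartAt 𝓘(ℝ, E) z x) (Metric.closedBall_subset_closedBall' (by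
      rw [Metric.mem_closedBall] at hxB; linarith))
  refine ⟨u, hu, hua, fun τ hτ y => ?_⟩
  have hub : MapsTo u (uIcc a b) (Metric.ball (extChartAt 𝓘(ℝ, E) z z) r) := by
    intro t ht
    have hdist : dist (u t) (extChartAt 𝓘(ℝ, E) z x) ≤ r / 4 := by
      rw [← hua, dist_eq_norm, hu.eq_integral t ht, add_sub_cancel_left]
      exact (hcar.norm_integral_le hu.mapsTo ht).trans hmr
    rw [Metric.mem_closedBall] at hxB
    rw [Metric.mem_ball]
    linarith [dist_triangle (u t) (extChartAt 𝓘(ℝ, E) z x) (extChartAt 𝓘(ℝ, E) z z)]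
  have hsource : (extChartAt 𝓘(ℝ, E) z).symm (u a) = x := by
    rw [hua, (extChartAt 𝓘(ℝ, E) z).left_inv (by rwa [extChartAt_source])]
  refine ⟨fun hy => ?_, ?_⟩
  · obtain ⟨γ, hγ, hγa, rfl⟩ := hy.exists_isIntCurve_uIcc
    have hsubset : uIcc a τ ⊆ uIcc a b := uIcc_subset_uIcc_left hτ
    exact hγ.eqOn_extChartAt_symm hr hsub (hcar.mono hsubset)
      ((hcar.setIntegral_mono hsubset).trans hm) (hu.mono hcar left_mem_uIcc hτ)
      (hub.mono_left hsubset) (hγa.trans hsource.symm) right_mem_uIcc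
  · rintro rfl
    simpa only [hsource] using (hu.isIntCurve hT hsub hcar).reaches left_mem_uIcc hτ

end ChartFlow

/-! ### Lipschitz relations -/

section LipschitzRelation

variable {Y ι : Type*} [PseudoEMetricSpace Y] {R R₁ R₂ : Y → Y → Prop} {U V : Set Y}
  {C C₁ C₂ D D₁ D₂ : ℝ≥0}

/-- The relation `R` is total on `U`, moves points of `U` by at most `D`, and expands distances of
points of `U` by at most the factor `C`. Applied to the relation that `y` is reached from `x` along
an integral curve, this expresses existence, boundedness and Lipschitz dependence of the flow at
once. -/
structure LipschitzRelOn (R : Y → Y → Prop) (U : Set Y) (C D : ℝ≥0) : Prop where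
  exists_rel : ∀ x ∈ U, ∃ y, R x y
  edist_le : ∀ x ∈ U, ∀ y, R x y → edist x y ≤ D
  edist_le_mul : ∀ x₁ ∈ U, ∀ x₂ ∈ U, ∀ y₁ y₂, R x₁ y₁ → R x₂ y₂ → edist y₁ y₂ ≤ C * edist x₁ x₂

namespace LipschitzRelOn

theorem mono (h : LipschitzRelOn R U C₁ D₁) (hV : V ⊆ U) (hC : C₁ ≤ C₂) (hD : D₁ ≤ D₂) :
    LipschitzRelOn R V C₂ D₂ where
  exists_rel x hx := h.exists_rel x (hV hx)
  edist_le x hx y hy := (h.edist_le x (hV hx) y hy).trans (by gcongr)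
  edist_le_mul x₁ hx₁ x₂ hx₂ y₁ y₂ hy₁ hy₂ :=
    (h.edist_le_mul x₁ (hV hx₁) x₂ (hV hx₂) y₁ y₂ hy₁ hy₂).trans (by gcongr)

theorem comp (h₁ : LipschitzRelOn R₁ U C₁ D₁) (h₂ : LipschitzRelOn R₂ V C₂ D₂)
    (hUV : ∀ x ∈ U, ∀ y, R₁ x y → y ∈ V) :
    LipschitzRelOn (Relation.Comp R₁ R₂) U (C₂ * C₁) (D₁ + D₂) where
  exists_rel x hx := by
    obtain ⟨y, hy⟩ := h₁.exists_rel x hx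
    obtain ⟨w, hw⟩ := h₂.exists_rel y (hUV x hx y hy)
    exact ⟨w, y, hy, hw⟩
  edist_le := by
    rintro x hx w ⟨y, hy, hw⟩
    push_cast
    exact (edist_triangle x y w).trans
      (add_le_add (h₁.edist_le x hx y hy) (h₂.edist_le y (hUV x hx y hy) w hw))
  edist_le_mul := by
    rintro x₁ hx₁ x₂ hx₂ w₁ w₂ ⟨y₁, hy₁, hw₁⟩ ⟨y₂, hy₂, hw₂⟩
    push_cast
    rw [mul_assoc]
    exact (h₂.edist_le_mul y₁ (hUV x₁ hx₁ y₁ hy₁) y₂ (hUV x₂ hx₂ y₂ hy₂) w₁ w₂ hw₁ hw₂).trans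
      (by gcongr; exact h₁.edist_le_mul x₁ hx₁ x₂ hx₂ y₁ y₂ hy₁ hy₂)

/- Points at distance less than the Lebesgue number `δ` lie in a common member of the cover; the
images of more distant points are compared through the displacement bound. -/
theorem of_cover {K : Set Y} {s : Set ι} {U : ι → Set Y} {δ : ℝ≥0} (hδ : δ ≠ 0)
    (hcov : ∀ x ∈ K, ∃ i ∈ s, Metric.eball x δ ⊆ U i)
    (h : ∀ i ∈ s, LipschitzRelOn R (U i) C D) :
    LipschitzRelOn R K (max C (1 + 2 * D / δ)) D := by
  have hmem : ∀ x ∈ K, ∃ i ∈ s, x ∈ U i := fun x hx => by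
    obtain ⟨i, hi, hxi⟩ := hcov x hx
    exact ⟨i, hi, hxi (Metric.mem_eball_self (by positivity))⟩
  have hdisp : ∀ x ∈ K, ∀ y, R x y → edist x y ≤ D := fun x hx y hy => by
    obtain ⟨i, hi, hxi⟩ := hmem x hx
    exact (h i hi).edist_le x hxi y hy
  refine ⟨fun x hx => ?_, hdisp, fun x₁ hx₁ x₂ hx₂ y₁ y₂ hy₁ hy₂ => ?_⟩
  · obtain ⟨i, hi, hxi⟩ := hmem x hx
    exact (h i hi).exists_rel x hxi
  rcases lt_or_ge (edist x₂ x₁) δ with hlt | hge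
  · obtain ⟨i, hi, hxi⟩ := hcov x₁ hx₁
    refine ((h i hi).edist_le_mul x₁ (hxi (Metric.mem_eball_self (by positivity))) x₂
      (hxi hlt) y₁ y₂ hy₁ hy₂).trans ?_
    gcongr
    exact le_max_left _ _
  · rw [edist_comm] at hge
    calc edist y₁ y₂ ≤ edist y₁ x₁ + edist x₁ x₂ + edist x₂ y₂ := edist_triangle4 _ _ _ _
      _ ≤ D + edist x₁ x₂ + D := by
        rw [edist_comm y₁]
        gcongr
        exacts [hdisp x₁ hx₁ y₁ hy₁, hdisp x₂ hx₂ y₂ hy₂]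
      _ = edist x₁ x₂ + (2 * D / δ : ℝ≥0) * δ := by
        rw [← ENNReal.coe_mul, div_mul_cancel₀ _ hδ]
        push_cast
        ring
      _ ≤ (1 + 2 * D / δ : ℝ≥0) * edist x₁ x₂ := by
        rw [ENNReal.coe_add, ENNReal.coe_one, add_mul, one_mul]
        gcongr
      _ ≤ _ := by
        gcongr
        exact le_max_right _ _

theorem exists_eventually_of_isCompact {R : ι → Y → Y → Prop} {l : Filter ι} {K : Set Y}
    (hK : IsCompact K)
    (h : ∀ x ∈ K, ∃ C D : ℝ≥0, ∃ U ∈ 𝓝 x, ∀ᶠ i in l, LipschitzRelOn (R i) U C D) :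
    ∃ C D : ℝ≥0, ∀ᶠ i in l, LipschitzRelOn (R i) K C D := by
  choose! C D U hU hev using h
  obtain ⟨s, hsK, hcov⟩ := hK.elim_nhds_subcover (fun x => interior (U x))
    fun x hx => interior_mem_nhds.2 (hU x hx)
  obtain ⟨δ, hδ, hball⟩ := lebesgue_number_lemma_of_emetric
    (c := fun x : s => interior (U x)) hK (fun _ => isOpen_interior)
    (by rwa [iUnion_subtype])
  obtain ⟨ε, hε, hεδ⟩ := ENNReal.lt_iff_exists_nnreal_btwn.1 hδ
  refine ⟨_, s.sup D, ((eventually_all_finset s).2 fun x hx => hev x (hsK x hx)).mono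
    fun i hi => of_cover (C := s.sup C) (s := (s : Set Y)) (U := U) (δ := ε)
      (by exact_mod_cast hε.ne') (fun x hx => ?_)
      fun x hx => (hi x hx).mono Subset.rfl (Finset.le_sup hx) (Finset.le_sup hx)⟩
  obtain ⟨y, hy⟩ := hball x hx
  exact ⟨y, y.2, (Metric.eball_subset_eball hεδ.le).trans (hy.trans interior_subset)⟩

end LipschitzRelOn

end LipschitzRelation

/-! ### The flow over short times -/

section IntegralBounds

variable {E : Type*} [NormedAddCommGroup E] [NormedSpace ℝ E]
  {M : Type*} [TopologicalSpace M] [ChartedSpace E M] [IsManifold 𝓘(ℝ, E) ∞ M]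
  [RiemannianBundle (fun x : M => TangentSpace 𝓘(ℝ, E) x)]
  {nabla : CovariantDerivative 𝓘(ℝ, E) E (fun x : M => TangentSpace 𝓘(ℝ, E) x)}
  {z : M} {C : ℝ≥0} {r : ℝ} {I S T : Set ℝ}

theorem exists_pos_forall_setIntegral_uIcc_lt {m : ℝ → ℝ} (hm : IntegrableOn m S) {ε : ℝ}
    (hε : 0 < ε) :
    ∃ δ > 0, ∀ a b, uIcc a b ⊆ S → |b - a| < δ → ∫ t in uIcc a b, m t < ε := by
  have hvol : Tendsto (volume.restrict S ∘ fun q : ℝ × ℝ => uIcc q.1 q.2)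
      (comap (fun q => |q.2 - q.1|) (𝓝 0)) (𝓝 0) := by
    have hlen := (ENNReal.continuous_ofReal.tendsto 0).comp
      (tendsto_comap (f := fun q : ℝ × ℝ => |q.2 - q.1|))
    rw [ENNReal.ofReal_zero] at hlen
    refine tendsto_of_tendsto_of_tendsto_of_le_of_le tendsto_const_nhds hlen
      (fun _ => zero_le) fun q => (Measure.restrict_apply_le S _).trans_eq ?_
    exact Real.volume_interval
  obtain ⟨δ, hδ, hsmall⟩ := (Metric.nhds_basis_ball.comap _).eventually_iff.1
    ((Integrable.tendsto_setIntegral_nhds_zero hm hvol).eventually_lt_const hε)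
  refine ⟨δ, hδ, fun a b hab hlt => ?_⟩
  have hab' := hsmall (x := (a, b)) (by simpa using hlt)
  rwa [Measure.restrict_restrict_of_subset hab] at hab'

theorem IsAdaptedRadius.isCaratheodoryOn {X : ℝ → (x : M) → TangentSpace 𝓘(ℝ, E) x}
    (h : IsAdaptedRadius nabla z C r) (hI : MeasurableSet I) (hlip : ∀ t ∈ I, IsLipSection (X t))
    (hmeas : ∀ x : M, AEStronglyMeasurable (fun t => X t x) (volume.restrict I))
    (hae : AEMeasurable (fun t => pLip nabla (chartBall (E := E) z r) (X t)) (volume.restrict I))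
    (hfin : ∫⁻ t in I, pLip nabla (chartBall (E := E) z r) (X t) ≠ ⊤) :
    IsCaratheodoryOn (fun t => chartRep z (X t))
      (fun t => C * (pLip nabla (chartBall (E := E) z r) (X t)).toNNReal)
      (Metric.closedBall (extChartAt 𝓘(ℝ, E) z z) r) I where
  measurable _ _ := (chartDeriv z _).continuous.comp_aestronglyMeasurable (hmeas _)
  integrable := (integrable_toReal_of_lintegral_ne_top hae hfin).const_mul (C : ℝ)
  bound := by
    filter_upwards [ae_lt_top' hae hfin] with t ht u hu
    exact h.norm_chartRep_le _ ht.ne u hu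
  lipschitz := by
    filter_upwards [ae_lt_top' hae hfin, ae_restrict_mem hI] with t ht htI
    exact h.lipschitzOnWith_chartRep _ (hlip t htI) ht.ne

variable {P : Type*} [TopologicalSpace P] {X : P → ℝ → (x : M) → TangentSpace 𝓘(ℝ, E) x}
  [FiniteDimensional ℝ E]

theorem IsLipPLI.exists_isCaratheodoryOn (hX : IsLipPLI nabla T X) (hS : IsCompact S)
    (hST : S ⊆ T) (hr : IsAdaptedRadius nabla z C r) (p : P) :
    ∃ m : ℝ → ℝ≥0, IsCaratheodoryOn (fun t => chartRep z (X p t)) m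
      (Metric.closedBall (extChartAt 𝓘(ℝ, E) z z) r) S := by
  obtain ⟨hlip, hmeas, hint⟩ := hX.isLipLI p
  obtain ⟨hae, hfin⟩ := hint _ (isCompact_chartBall hr.subset_target) S hST hS
  exact ⟨_, hr.isCaratheodoryOn hS.measurableSet (fun t ht => hlip t (hST ht))
    (fun x => (hmeas x).mono_set hST) hae hfin.ne⟩

theorem IsLipPLI.eventually_isCaratheodoryOn_sub (hX : IsLipPLI nabla T X) (hS : IsCompact S)
    (hST : S ⊆ T) (hr : IsAdaptedRadius nabla z C r) (p₀ : P) {ε : ℝ} (hε : 0 < ε) :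
    ∀ᶠ p in 𝓝 p₀, ∃ n : ℝ → ℝ≥0, IsCaratheodoryOn (fun t => chartRep z (X p t - X p₀ t)) n
      (Metric.closedBall (extChartAt 𝓘(ℝ, E) z z) r) S ∧ ∫ t in S, (n t : ℝ) ≤ ε := by
  filter_upwards [hX.continuous p₀ _ (isCompact_chartBall hr.subset_target) S hST hS
    (ENNReal.ofReal (ε / (C + 1))) (ENNReal.ofReal_pos.2 (by positivity))] with p ⟨hae, hlt⟩
  refine ⟨_, hr.isCaratheodoryOn hS.measurableSet
    (fun t ht => ((hX.isLipLI p).lip t (hST ht)).sub ((hX.isLipLI p₀).lip t (hST ht)))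
    (fun x => (((hX.isLipLI p).measurable x).mono_set hST).sub
      (((hX.isLipLI p₀).measurable x).mono_set hST)) hae hlt.ne_top, ?_⟩
  calc ∫ t in S, ((C * (pLip nabla (chartBall (E := E) z r) (X p t - X p₀ t)).toNNReal : ℝ≥0) : ℝ)
      = C * (∫⁻ t in S, pLip nabla (chartBall (E := E) z r) (X p t - X p₀ t)).toReal := by
        rw [← integral_toReal hae (ae_lt_top' hae hlt.ne_top), ← integral_const_mul]
        rfl
    _ ≤ (C + 1) * (ε / (C + 1)) := by
        gcongr
        · exact le_add_of_nonneg_right zero_le_one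
        · exact ENNReal.toReal_le_of_le_ofReal (by positivity) hlt.le
    _ = ε := mul_div_cancel₀ ε (by positivity)

end IntegralBounds

section ShortTime

variable {E : Type*} [NormedAddCommGroup E] [NormedSpace ℝ E] [FiniteDimensional ℝ E]

section Chart

variable {M : Type*} [TopologicalSpace M] [ChartedSpace E M] [IsManifold 𝓘(ℝ, E) ∞ M] [T2Space M]
  {T : Set ℝ} {X X' : ℝ → (x : M) → TangentSpace 𝓘(ℝ, E) x} {z x x' y y' : M} {m m' n : ℝ → ℝ≥0}
  {r a b τ : ℝ}

omit [FiniteDimensional ℝ E] [IsManifold 𝓘(ℝ, E) ∞ M] [T2Space M] in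
theorem chartBall_mem_nhds (hr : 0 < r)
    (hsub : Metric.closedBall (extChartAt 𝓘(ℝ, E) z z) r ⊆ (extChartAt 𝓘(ℝ, E) z).target) :
    chartBall (E := E) z r ∈ 𝓝 z := by
  filter_upwards [chart_source_mem_nhds E z,
    (continuousAt_extChartAt (I := 𝓘(ℝ, E)) z).preimage_mem_nhds
      (Metric.closedBall_mem_nhds _ hr)] with y hys hy
  exact (mem_chartBall_iff hsub).2 ⟨hys, hy⟩

namespace IsPicardOn

omit [FiniteDimensional ℝ E] [T2Space M] in
theorem add (hr : 0 < r)
    (hsub : Metric.closedBall (extChartAt 𝓘(ℝ, E) z z) r ⊆ (extChartAt 𝓘(ℝ, E) z).target)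
    (hm : IsCaratheodoryOn (fun t => chartRep z (X t)) m
      (Metric.closedBall (extChartAt 𝓘(ℝ, E) z z) r) (uIcc a b))
    (hn : IsCaratheodoryOn (fun t => chartRep z (X' t - X t)) n
      (Metric.closedBall (extChartAt 𝓘(ℝ, E) z z) r) (uIcc a b))
    (hm_le : ∫ t in uIcc a b, (m t : ℝ) ≤ min (1 / 4) (r / 8))
    (hn_le : ∫ t in uIcc a b, (n t : ℝ) ≤ min (1 / 4) (r / 8)) :
    IsPicardOn X' z r (m + n) a b := by
  have hsum : ∫ t in uIcc a b, ((m + n) t : ℝ) =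
      (∫ t in uIcc a b, (m t : ℝ)) + ∫ t in uIcc a b, (n t : ℝ) :=
    integral_add hm.integrable hn.integrable
  rw [le_min_iff] at hm_le hn_le
  refine ⟨hr, hsub, ?_, by linarith, by linarith⟩
  convert hm.add hn using 1
  ext t u
  rw [Pi.add_apply, Pi.add_apply, chartRep, chartRep, chartRep, localRep_sub, add_sub_cancel]

theorem mem_chartBall (h : IsPicardOn X z r m a b) (hT : uIcc a b ⊆ T) (hτ : τ ∈ uIcc a b)
    (hx : x ∈ chartBall (E := E) z (r / 2)) (hy : Reaches T X τ a x y) :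
    y ∈ chartBall (E := E) z r := by
  obtain ⟨u, hu, -, hreach⟩ := h.exists_isIntegralSolution_reaches_iff hT hx
  rw [(hreach τ hτ y).1 hy]
  exact mem_image_of_mem _ (hu.mapsTo hτ)

theorem dist_extChartAt_le (h : IsPicardOn X z r m a b) (h' : IsPicardOn X' z r m' a b)
    (hT : uIcc a b ⊆ T) {k : ℝ → ℝ} (hk : IntegrableOn k (uIcc a b))
    (hXX' : ∀ᵐ t ∂volume.restrict (uIcc a b),
      ∀ u ∈ Metric.closedBall (extChartAt 𝓘(ℝ, E) z z) r,
        ‖chartRep z (X' t) u - chartRep z (X t) u‖ ≤ k t) (hτ : τ ∈ uIcc a b)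
    (hx : x ∈ chartBall (E := E) z (r / 2)) (hx' : x' ∈ chartBall (E := E) z (r / 2))
    (hy : Reaches T X τ a x y) (hy' : Reaches T X' τ a x' y') :
    dist (extChartAt 𝓘(ℝ, E) z y') (extChartAt 𝓘(ℝ, E) z y) ≤
      2 * (dist (extChartAt 𝓘(ℝ, E) z x') (extChartAt 𝓘(ℝ, E) z x) +
        ∫ t in uIcc a b, k t) := by
  obtain ⟨u, hu, hua, hreach⟩ := h.exists_isIntegralSolution_reaches_iff hT hx
  obtain ⟨u', hu', hua', hreach'⟩ := h'.exists_isIntegralSolution_reaches_iff hT hx'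
  rw [(hreach τ hτ y).1 hy, (hreach' τ hτ y').1 hy',
    (extChartAt 𝓘(ℝ, E) z).right_inv (h.subset_target (hu.mapsTo hτ)),
    (extChartAt 𝓘(ℝ, E) z).right_inv (h.subset_target (hu'.mapsTo hτ)),
    ← hua, ← hua', dist_eq_norm, dist_eq_norm]
  exact hu'.norm_sub_le h'.isCaratheodoryOn h.isCaratheodoryOn h'.integral_le_half hk hXX' hu hτ

theorem exists_pos_forall_reaches_mem (h : IsPicardOn X z r m a b) (hT : uIcc a b ⊆ T)
    (hx : x ∈ chartBall (E := E) z (r / 2)) (hy : Reaches T X b a x y) {W : Set M}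
    (hW : W ∈ 𝓝 y) :
    ∃ ε > 0, ∃ U ∈ 𝓝 x, ∀ (X' : ℝ → (x : M) → TangentSpace 𝓘(ℝ, E) x) (m' n : ℝ → ℝ≥0),
      IsPicardOn X' z r m' a b →
      IsCaratheodoryOn (fun t => chartRep z (X' t - X t)) n
        (Metric.closedBall (extChartAt 𝓘(ℝ, E) z z) r) (uIcc a b) →
      ∫ t in uIcc a b, (n t : ℝ) ≤ ε →
      ∀ x' ∈ U ∩ chartBall (E := E) z (r / 2), ∀ y', Reaches T X' b a x' y' → y' ∈ W := by
  have hmem := (mem_chartBall_iff h.subset_target).1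
    (h.mem_chartBall hT right_mem_uIcc hx hy)
  have hxs := ((mem_chartBall_iff ((Metric.closedBall_subset_closedBall
    (half_le_self h.pos.le)).trans h.subset_target)).1 hx).1
  obtain ⟨η, hη, hηW⟩ := Metric.mem_nhds_iff.1
    ((continuousAt_extChartAt_symm'' (h.subset_target hmem.2)).preimage_mem_nhds
      ((((extChartAt 𝓘(ℝ, E) z).left_inv (by rw [extChartAt_source]; exact hmem.1)).symm ▸ hW)))
  have hU : extChartAt 𝓘(ℝ, E) z ⁻¹' Metric.ball (extChartAt 𝓘(ℝ, E) z x) (η / 5) ∈ 𝓝 x :=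
    (continuousAt_extChartAt' (by rwa [extChartAt_source])).preimage_mem_nhds
      (Metric.ball_mem_nhds _ (by positivity))
  refine ⟨η / 5, by positivity, _, hU, fun X' m' n h' hn hnε x' hx' y' hy' => ?_⟩
  have hclose : dist (extChartAt 𝓘(ℝ, E) z x') (extChartAt 𝓘(ℝ, E) z x) < η / 5 := hx'.1
  have hle := h.dist_extChartAt_le h' hT hn.integrable (hn.bound.mono fun t ht u hu => by
    rw [chartRep, chartRep, ← localRep_sub]
    exact ht u hu) right_mem_uIcc hx hx'.2 hy hy'
  have hW' := hηW (Metric.mem_ball.2 (hle.trans_lt (by linarith)))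
  have hy's := ((mem_chartBall_iff h.subset_target).1
    (h'.mem_chartBall hT right_mem_uIcc hx'.2 hy')).1
  rwa [mem_preimage, (extChartAt 𝓘(ℝ, E) z).left_inv (by rwa [extChartAt_source])] at hW'

end IsPicardOn

end Chart

variable {M : Type*} [PseudoEMetricSpace M] [ChartedSpace E M] [IsManifold 𝓘(ℝ, E) ∞ M]
  [T2Space M] {T : Set ℝ}

omit [FiniteDimensional ℝ E] [IsManifold 𝓘(ℝ, E) ∞ M] [T2Space M] in
theorem edist_le_mul_edist_extChartAt {z y₁ y₂ : M} {r : ℝ} {D : ℝ≥0}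
    (hsub : Metric.closedBall (extChartAt 𝓘(ℝ, E) z z) r ⊆ (extChartAt 𝓘(ℝ, E) z).target)
    (hD : LipschitzOnWith D (extChartAt 𝓘(ℝ, E) z).symm
      (Metric.closedBall (extChartAt 𝓘(ℝ, E) z z) r))
    (hy₁ : y₁ ∈ chartBall (E := E) z r) (hy₂ : y₂ ∈ chartBall (E := E) z r) :
    edist y₁ y₂ ≤ D * edist (extChartAt 𝓘(ℝ, E) z y₁) (extChartAt 𝓘(ℝ, E) z y₂) := by
  obtain ⟨hs₁, hB₁⟩ := (mem_chartBall_iff hsub).1 hy₁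
  obtain ⟨hs₂, hB₂⟩ := (mem_chartBall_iff hsub).1 hy₂
  rw [← extChartAt_source 𝓘(ℝ, E)] at hs₁ hs₂
  have hle := hD hB₁ hB₂
  rwa [(extChartAt 𝓘(ℝ, E) z).left_inv hs₁, (extChartAt 𝓘(ℝ, E) z).left_inv hs₂] at hle

theorem IsPicardOn.lipschitzRelOn_reaches {X : ℝ → (x : M) → TangentSpace 𝓘(ℝ, E) x} {z : M}
    {m : ℝ → ℝ≥0} {r a b τ : ℝ} {D D' : ℝ≥0} (h : IsPicardOn X z r m a b) (hT : uIcc a b ⊆ T)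
    (hD : LipschitzOnWith D (extChartAt 𝓘(ℝ, E) z).symm
      (Metric.closedBall (extChartAt 𝓘(ℝ, E) z z) r))
    (hD' : LipschitzOnWith D' (extChartAt 𝓘(ℝ, E) z) (chartBall (E := E) z r))
    (hτ : τ ∈ uIcc a b) :
    LipschitzRelOn (Reaches T X τ a) (chartBall (E := E) z (r / 2)) (D * (2 * D'))
      (D * (2 * r).toNNReal) := by
  have hsub : chartBall (E := E) z (r / 2) ⊆ chartBall z r :=
    image_mono (Metric.closedBall_subset_closedBall (half_le_self h.pos.le))
  refine ⟨fun x hx => ?_, fun x hx y hy => ?_, fun x₁ hx₁ x₂ hx₂ y₁ y₂ hy₁ hy₂ => ?_⟩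
  · obtain ⟨u, -, -, hreach⟩ := h.exists_isIntegralSolution_reaches_iff hT hx
    exact ⟨_, (hreach τ hτ _).2 rfl⟩
  · have hy' := h.mem_chartBall hT hτ hx hy
    refine (edist_le_mul_edist_extChartAt h.subset_target hD (hsub hx) hy').trans ?_
    rw [ENNReal.coe_mul]
    gcongr
    refine (edist_le_ofReal (by linarith [h.pos])).2 ((dist_triangle_right _ _
      (extChartAt 𝓘(ℝ, E) z z)).trans ?_)
    linarith [Metric.mem_closedBall.1 ((mem_chartBall_iff h.subset_target).1 (hsub hx)).2,
      Metric.mem_closedBall.1 ((mem_chartBall_iff h.subset_target).1 hy').2]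
  · refine (edist_le_mul_edist_extChartAt h.subset_target hD (h.mem_chartBall hT hτ hx₁ hy₁)
      (h.mem_chartBall hT hτ hx₂ hy₂)).trans ?_
    push_cast
    rw [mul_assoc]
    gcongr
    calc edist (extChartAt 𝓘(ℝ, E) z y₁) (extChartAt 𝓘(ℝ, E) z y₂)
        ≤ 2 * edist (extChartAt 𝓘(ℝ, E) z x₁) (extChartAt 𝓘(ℝ, E) z x₂) := by
          have hle := h.dist_extChartAt_le h hT integrableOn_zero (ae_of_all _ fun t u _ => by
            rw [sub_self, norm_zero]) hτ hx₂ hx₁ hy₂ hy₁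
          rw [edist_dist, edist_dist, ← ENNReal.ofReal_ofNat, ← ENNReal.ofReal_mul zero_le_two]
          exact ENNReal.ofReal_le_ofReal (by simpa using hle)
      _ ≤ 2 * D' * edist x₁ x₂ := by
          rw [mul_assoc]
          gcongr
          exact hD' (hsub hx₁) (hsub hx₂)

end ShortTime

/-! ### The flow along an integral curve -/

theorem rel_of_locally_rel {Q : ℝ → ℝ → Prop} {a b : ℝ}
    (htrans : ∀ r s t, s ∈ uIcc r t → Q r s → Q s t → Q r t)
    (hloc : ∀ t ∈ uIcc a b, ∃ V ∈ 𝓝[uIcc a b] t, ∀ r ∈ V, ∀ s ∈ V, Q r s) : Q a b := by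
  wlog hab : a ≤ b generalizing a b Q
  · exact this (Q := fun r s => Q s r) (fun r s t hs hrs hst => htrans t s r (uIcc_comm r t ▸ hs)
      hst hrs) (fun t ht => by
        obtain ⟨V, hV, hQ⟩ := hloc t (uIcc_comm b a ▸ ht)
        exact ⟨V, uIcc_comm b a ▸ hV, fun r hr s hs => hQ s hs r hr⟩) (le_of_not_ge hab)
  rw [uIcc_of_le hab] at hloc
  choose! V hV hQ using hloc
  obtain ⟨t, ht0, htm, ⟨n, hn⟩, htV⟩ := exists_monotone_Icc_subset_open_cover_Icc hab
    (c := fun i : Icc a b => interior (Subtype.val ⁻¹' V i)) (fun _ => isOpen_interior)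
    fun i _ => mem_iUnion.2 ⟨i, mem_interior_iff_mem_nhds.2
      (preimage_coe_mem_nhds_subtype.2 (hV i i.2))⟩
  have hind : ∀ k, Q a (t k) := by
    intro k
    induction k with
    | zero =>
      obtain ⟨i, hi⟩ := htV 0
      have h0 := interior_subset (hi ⟨le_rfl, htm zero_le_one⟩)
      rw [mem_preimage, ht0] at h0
      rw [ht0]
      exact hQ i i.2 a h0 a h0
    | succ k ih =>
      obtain ⟨i, hi⟩ := htV k
      have hle := htm (Nat.le_succ k)
      have hk := interior_subset (hi ⟨le_rfl, hle⟩)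
      have hk' := interior_subset (hi ⟨hle, le_rfl⟩)
      exact htrans a (t k) (t (k + 1)) (Icc_subset_uIcc ⟨(t k).2.1, hle⟩) ih (hQ i i.2 _ hk _ hk')
  simpa only [hn n le_rfl] using hind n

section FlowStep

variable {E : Type*} [NormedAddCommGroup E] [NormedSpace ℝ E]
  {M : Type*} [PseudoEMetricSpace M] [ChartedSpace E M]
  {P : Type*} [TopologicalSpace P]

/-- From time `a` to time `b`, the integral curves starting near `x₀` for parameters near `p₀`
exist, move points by a bounded amount and expand distances by a bounded factor, and end up near
`y₀`. -/
def HasLipschitzFlow (T : Set ℝ) (X : P → ℝ → (x : M) → TangentSpace 𝓘(ℝ, E) x) (p₀ : P)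
    (a b : ℝ) (x₀ y₀ : M) : Prop :=
  ∀ W ∈ 𝓝 y₀, ∃ C D : ℝ≥0, ∃ U ∈ 𝓝 x₀, ∀ᶠ p in 𝓝 p₀,
    (∀ τ ∈ uIcc a b, LipschitzRelOn (Reaches T (X p) τ a) U C D) ∧
      ∀ x ∈ U, ∀ y, Reaches T (X p) b a x y → y ∈ W

variable {T : Set ℝ} {X : P → ℝ → (x : M) → TangentSpace 𝓘(ℝ, E) x} {p₀ : P}

theorem HasLipschitzFlow.trans {a b c : ℝ} {x₀ y₀ z₀ : M}
    (h₁ : HasLipschitzFlow T X p₀ a b x₀ y₀) (h₂ : HasLipschitzFlow T X p₀ b c y₀ z₀)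
    (hb : b ∈ uIcc a c) : HasLipschitzFlow T X p₀ a c x₀ z₀ := by
  intro W hW
  obtain ⟨C₂, D₂, V, hV, h₂⟩ := h₂ W hW
  obtain ⟨C₁, D₁, U, hU, h₁⟩ := h₁ V hV
  refine ⟨max C₁ (C₂ * C₁), D₁ + D₂, U, hU, ?_⟩
  filter_upwards [h₁, h₂] with p ⟨h₁, hUV⟩ ⟨h₂, hVW⟩
  refine ⟨fun τ hτ => ?_, fun x hx y hy => ?_⟩
  · by_cases hτb : τ ∈ uIcc b c
    · rw [reaches_eq_comp (b := b) (by grind [mem_uIcc])]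
      exact ((h₁ b right_mem_uIcc).comp (h₂ τ hτb) hUV).mono Subset.rfl (le_max_right _ _) le_rfl
    · exact (h₁ τ ((uIcc_subset_uIcc_union_uIcc hτ).resolve_right hτb)).mono Subset.rfl
        (le_max_left _ _) le_self_add
  · obtain ⟨w, hw, hwy⟩ := hy.exists_between hb
    exact hVW w (hUV x hx w hw) y hwy

variable [IsManifold 𝓘(ℝ, E) ∞ M] [FiniteDimensional ℝ E] [T2Space M]
  [RiemannianBundle (fun x : M => TangentSpace 𝓘(ℝ, E) x)]
  [IsContinuousRiemannianBundle E (fun x : M => TangentSpace 𝓘(ℝ, E) x)]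
  [IsRiemannianManifold 𝓘(ℝ, E) M]
  {nabla : CovariantDerivative 𝓘(ℝ, E) E (fun x : M => TangentSpace 𝓘(ℝ, E) x)}

theorem IsLipPLI.exists_hasLipschitzFlow (hX : IsLipPLI nabla T X)
    (hnabla : nabla.ContMDiffCovariantDerivative ∞) (p₀ : P) {S : Set ℝ} (hS : IsCompact S)
    (hST : S ⊆ T) (z : M) :
    ∃ δ > 0, ∃ N ∈ 𝓝 z, ∀ a b : ℝ, uIcc a b ⊆ S → |b - a| < δ → ∀ x₀ ∈ N, ∀ y₀,
      Reaches T (X p₀) b a x₀ y₀ → HasLipschitzFlow T X p₀ a b x₀ y₀ := by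
  obtain ⟨C, hC⟩ := exists_eventually_isAdaptedRadius hnabla z
  obtain ⟨D, hD⟩ := exists_eventually_lipschitzOnWith_extChartAt_symm (E := E) z
  obtain ⟨D', hD'⟩ := exists_eventually_lipschitzOnWith_extChartAt_chartBall (E := E) z
  obtain ⟨r, hr, hDr, hD'r, hr0⟩ := (hC.and (hD.and (hD'.and self_mem_nhdsWithin))).exists
  have hε₀ : 0 < min (1 / 4) (r / 8) := by positivity
  obtain ⟨m, hm⟩ := hX.exists_isCaratheodoryOn hS hST hr p₀
  obtain ⟨δ, hδ, hshort⟩ := exists_pos_forall_setIntegral_uIcc_lt hm.integrable hε₀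
  refine ⟨δ, hδ, interior (chartBall (E := E) z (r / 2)), interior_mem_nhds.2
    (chartBall_mem_nhds (half_pos hr0) ((Metric.closedBall_subset_closedBall
      (half_le_self hr0.le)).trans hr.subset_target)), fun a b hab hlt x₀ hx₀ y₀ hy₀ W hW => ?_⟩
  have hm_le := (hshort a b hab hlt).le
  have hpic₀ : IsPicardOn (X p₀) z r m a b := ⟨hr0, hr.subset_target, hm.mono hab,
    by linarith [(le_min_iff.1 hm_le).1], by linarith [(le_min_iff.1 hm_le).2]⟩
  obtain ⟨ε, hε, U, hU, hland⟩ := hpic₀.exists_pos_forall_reaches_mem (hab.trans hST)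
    (interior_subset hx₀) hy₀ hW
  refine ⟨D * (2 * D'), D * (2 * r).toNNReal, _,
    inter_mem hU (mem_interior_iff_mem_nhds.1 hx₀), ?_⟩
  filter_upwards [hX.eventually_isCaratheodoryOn_sub hS hST hr p₀ (lt_min hε hε₀)]
    with p ⟨n, hn, hnε⟩
  have hn_le := (hn.setIntegral_mono hab).trans hnε
  have hpic := IsPicardOn.add hr0 hr.subset_target (hm.mono hab) (hn.mono hab) hm_le
    (hn_le.trans (min_le_right _ _))
  exact ⟨fun τ hτ => (hpic.lipschitzRelOn_reaches (hab.trans hST) hDr hD'r hτ).mono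
    inter_subset_right le_rfl le_rfl,
    hland (X p) _ n hpic (hn.mono hab) (hn_le.trans (min_le_left _ _))⟩

theorem IsIntCurve.hasLipschitzFlow (hX : IsLipPLI nabla T X)
    (hnabla : nabla.ContMDiffCovariantDerivative ∞) {γ : ℝ → M} {t₀ t₁ : ℝ}
    (hγ : IsIntCurve T (X p₀) γ (uIcc t₀ t₁)) :
    HasLipschitzFlow T X p₀ t₀ t₁ (γ t₀) (γ t₁) := by
  refine rel_of_locally_rel (Q := fun s t => HasLipschitzFlow T X p₀ s t (γ s) (γ t))
    (fun _ _ _ hs hrs hst => hrs.trans hst hs) fun t ht => ?_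
  obtain ⟨δ, hδ, N, hN, hstep⟩ :=
    hX.exists_hasLipschitzFlow hnabla p₀ isCompact_uIcc hγ.subset (γ t)
  refine ⟨uIcc t₀ t₁ ∩ (Metric.ball t (δ / 2) ∩ γ ⁻¹' N), inter_mem self_mem_nhdsWithin
    (inter_mem (mem_nhdsWithin_of_mem_nhds (Metric.ball_mem_nhds t (half_pos hδ)))
      (hγ.locAC.continuousOn left_mem_uIcc right_mem_uIcc t ht hN)), ?_⟩
  rintro r ⟨hr, hrt, hrN⟩ s ⟨hs, hst, -⟩
  refine hstep r s (uIcc_subset_uIcc hr hs) ?_ _ hrN _ (hγ.reaches hr hs)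
  rw [← Real.dist_eq]
  exact (dist_triangle_right s r t).trans_lt ((add_lt_add hst hrt).trans_eq (add_halves δ))

theorem IsLipPLI.exists_eventually_lipschitzRelOn_reaches (hX : IsLipPLI nabla T X)
    (hnabla : nabla.ContMDiffCovariantDerivative ∞) {t₀ t₁ : ℝ} {K : Set M} (hK : IsCompact K)
    (hreach : ∀ x ∈ K, ∃ y, Reaches T (X p₀) t₁ t₀ x y) :
    ∃ C D : ℝ≥0, ∀ᶠ p in 𝓝 p₀, ∀ t ∈ uIcc t₀ t₁, LipschitzRelOn (Reaches T (X p) t t₀) K C D := by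
  obtain ⟨C, D, h⟩ := LipschitzRelOn.exists_eventually_of_isCompact (l := 𝓝 p₀ ×ˢ 𝓟 (uIcc t₀ t₁))
    (R := fun q : P × ℝ => Reaches T (X q.1) q.2 t₀) hK fun x hx => by
      obtain ⟨y, hy⟩ := hreach x hx
      obtain ⟨γ, hγ, rfl, rfl⟩ := hy.exists_isIntCurve_uIcc
      obtain ⟨C, D, U, hU, hflow⟩ := hγ.hasLipschitzFlow hX hnabla univ univ_mem
      exact ⟨C, D, U, hU, eventually_prod_principal_iff.2 (hflow.mono fun p hp => hp.1)⟩
  exact ⟨C, D, eventually_prod_principal_iff.1 h⟩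

end FlowStep

section Flow

variable {E : Type*} [NormedAddCommGroup E] [NormedSpace ℝ E]
  {M : Type*} [TopologicalSpace M] [ChartedSpace E M]

theorem reaches_flow {P : Type*} {T : Set ℝ} {X : P → ℝ → (x : M) → TangentSpace 𝓘(ℝ, E) x}
    {t t₀ : ℝ} {x : M} {p : P} (h : ∃ y, Reaches T (X p) t t₀ x y) :
    Reaches T (X p) t t₀ x (flow T X t t₀ x p) := by
  rw [flow, dif_pos h]
  exact h.choose_spec

end Flow

theorem isContinuousRiemannianBundle_of_isContMDiffRiemannianBundle {EB : Type*}
    [NormedAddCommGroup EB] [NormedSpace ℝ EB] {HB : Type*} [TopologicalSpace HB]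
    (IB : ModelWithCorners ℝ EB HB) (n : ℕ∞ω) {B : Type*} [TopologicalSpace B] [ChartedSpace HB B]
    (F : Type*) [NormedAddCommGroup F] [NormedSpace ℝ F] (V : B → Type*)
    [TopologicalSpace (TotalSpace F V)] [∀ x, NormedAddCommGroup (V x)]
    [∀ x, InnerProductSpace ℝ (V x)] [FiberBundle F V] [VectorBundle ℝ F V]
    [IsContMDiffRiemannianBundle IB n F V] : IsContinuousRiemannianBundle F V where
  exists_continuous := by
    obtain ⟨g, hg, hgx⟩ :=
      IsContMDiffRiemannianBundle.exists_contMDiff (IB := IB) (n := n) (F := F) (E := V)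
    exact ⟨g, hg.continuous, hgx⟩

end LipFlow

end

theorem corollary3p12_general
    {E : Type*} [NormedAddCommGroup E] [NormedSpace ℝ E] [FiniteDimensional ℝ E]
    {M : Type*} [TopologicalSpace M] [ChartedSpace E M] [IsManifold 𝓘(ℝ, E) ∞ M] [T2Space M]
    [RiemannianBundle (fun x : M => TangentSpace 𝓘(ℝ, E) x)]
    [IsContinuousRiemannianBundle E (fun x : M => TangentSpace 𝓘(ℝ, E) x)]
    (nabla : CovariantDerivative 𝓘(ℝ, E) E (fun x : M => TangentSpace 𝓘(ℝ, E) x))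
    (hnabla : nabla.ContMDiffCovariantDerivative ∞)
    {P : Type*} [TopologicalSpace P]
    (T : Set ℝ) (hT : T.OrdConnected)
    (X : P → ℝ → (x : M) → TangentSpace 𝓘(ℝ, E) x)
    (hX : LipFlow.IsLipPLI nabla T X)
    (K : Set M) (hK : IsCompact K)
    (t₀ t₁ : ℝ) (ht₀ : t₀ ∈ T) (ht₁ : t₁ ∈ T) (p₀ : P)
    (hdom : ∀ x ∈ K, (t₁, t₀, x, p₀) ∈ LipFlow.flowDomain T X) :
    ∃ O ∈ 𝓝 p₀, ∃ C : ℝ, 0 < C ∧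
      (∀ t ∈ uIcc t₀ t₁, ∀ x ∈ K, ∀ p ∈ O, (t, t₀, x, p) ∈ LipFlow.flowDomain T X) ∧
      ∀ t ∈ uIcc t₀ t₁, ∀ x₁ ∈ K, ∀ x₂ ∈ K, ∀ p ∈ O,
        Manifold.riemannianEDist 𝓘(ℝ, E)
            (LipFlow.flow T X t t₀ x₁ p) (LipFlow.flow T X t t₀ x₂ p)
          ≤ ENNReal.ofReal C * Manifold.riemannianEDist 𝓘(ℝ, E) x₁ x₂ := by
  have : LocallyCompactSpace M := ChartedSpace.locallyCompactSpace E M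
  let : PseudoEMetricSpace M := .ofRiemannianMetric 𝓘(ℝ, E) M
  obtain ⟨C, D, hlip⟩ := hX.exists_eventually_lipschitzRelOn_reaches hnabla (t₁ := t₁) hK
    fun x hx => (hdom x hx).2.2
  refine ⟨_, hlip, C + 1, by positivity, fun t ht x hx p hp =>
    ⟨hT.uIcc_subset ht₀ ht₁ ht, ht₀, (hp t ht).exists_rel x hx⟩, fun t ht x₁ hx₁ x₂ hx₂ p hp => ?_⟩
  have hflow : ∀ x ∈ K, LipFlow.Reaches T (X p) t t₀ x (LipFlow.flow T X t t₀ x p) :=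
    fun x hx => LipFlow.reaches_flow ((hp t ht).exists_rel x hx)
  have hC : (C : ℝ≥0∞) ≤ ENNReal.ofReal (C + 1) := by
    rw [← ENNReal.ofReal_coe_nnreal]
    exact ENNReal.ofReal_le_ofReal (le_add_of_nonneg_right zero_le_one)
  exact ((hp t ht).edist_le_mul x₁ hx₁ x₂ hx₂ _ _ (hflow x₁ hx₁) (hflow x₂ hx₂)).trans
    (mul_le_mul_left hC _)

theorem corollary3p12
    {E : Type*} [NormedAddCommGroup E] [NormedSpace ℝ E] [FiniteDimensional ℝ E]
    {M : Type*} [TopologicalSpace M] [ChartedSpace E M] [IsManifold 𝓘(ℝ, E) ∞ M]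
    [T2Space M] [SecondCountableTopology M] [ConnectedSpace M]
    [RiemannianBundle (fun x : M => TangentSpace 𝓘(ℝ, E) x)]
    [IsContMDiffRiemannianBundle 𝓘(ℝ, E) ∞ E (fun x : M => TangentSpace 𝓘(ℝ, E) x)]
    (nabla : CovariantDerivative 𝓘(ℝ, E) E (fun x : M => TangentSpace 𝓘(ℝ, E) x))
    (hnabla : LipFlow.IsLeviCivita nabla)
    {P : Type*} [TopologicalSpace P]
    (T : Set ℝ) (hT : T.OrdConnected)
    (X : P → ℝ → (x : M) → TangentSpace 𝓘(ℝ, E) x)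
    (hX : LipFlow.IsLipPLI nabla T X)
    (K : Set M) (hK : IsCompact K)
    (t₀ t₁ : ℝ) (ht₀ : t₀ ∈ T) (ht₁ : t₁ ∈ T) (p₀ : P)
    (hdom : ∀ t ∈ uIcc t₀ t₁, ∀ x ∈ K, (t, t₀, x, p₀) ∈ LipFlow.flowDomain T X) :
    ∃ O ∈ 𝓝 p₀, ∃ C : ℝ, 0 < C ∧
      (∀ t ∈ uIcc t₀ t₁, ∀ x ∈ K, ∀ p ∈ O, (t, t₀, x, p) ∈ LipFlow.flowDomain T X) ∧
      ∀ t ∈ uIcc t₀ t₁, ∀ x₁ ∈ K, ∀ x₂ ∈ K, ∀ p ∈ O,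
        Manifold.riemannianEDist 𝓘(ℝ, E)
            (LipFlow.flow T X t t₀ x₁ p) (LipFlow.flow T X t t₀ x₂ p)
          ≤ ENNReal.ofReal C * Manifold.riemannianEDist 𝓘(ℝ, E) x₁ x₂ :=
  have := LipFlow.isContinuousRiemannianBundle_of_isContMDiffRiemannianBundle 𝓘(ℝ, E) ∞ E
    fun x : M => TangentSpace 𝓘(ℝ, E) x
  corollary3p12_general nabla hnabla.smooth T hT X hX K hK t₀ t₁ ht₀ ht₁ p₀ (hdom t₁ right_mem_uIcc)
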